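/- Let $d\ge 3$ be an integer. There exist a smooth Riemannian metric $g$ on $\mathcal M=\mathbb R^d$ and a smooth function $f:\mathcal M\to\mathbb R$ such that, with $o=0$, $r(x)=\mathrm{dist}_g(x,o)$, $d\mu=e^{-f}\,d\nu_g$ (where $\nu_g$ is the Riemannian volume), $\mathcal L w=\Delta w-\nabla f\cdot\nabla w$ and $\mathrm{Ric}_{\infty,d}=\mathrm{Ric}+\nabla^2 f$, the following holds (all metric and differential notions are those of $g$). (a) $(\mathcal M,g,\mu)$ is a weighted model manifold with pole $o$: in polar coordinates $(\rho,\theta)\in(0,\infty)\times\mathbb S^{d-1}$ on $\mathbb R^d\setminus\{0\}$ one has $g=d\rho^2+\psi(\rho)^2\,d\theta^2$ with $\psi$ smooth on $[0,\infty)$, $\psi^{(2k)}(0)=0$ for every integer $k\ge0$, $\psi'(0)=1$ and $\psi'>0$ on $(0,\infty)$; and $f$ is a function of $r$ only. Moreover $(\mathcal M,g)$ is complete (and non-compact, without boundary, diffeomorphic to $\mathbb R^d$). (b) $\mathrm{Ric}_{\infty,d}\ge 0$ on $\mathcal M$, and $\mathrm{Ric}_{\infty,d}>0$ on $\mathcal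 M\setminus\{o\}$. (c) There is $C>0$ with $\mu(\mathcal B_R(o))\le C R^d$ for all $R>0$. (d) The inequality $\mathcal L r\le \frac{d-1}{r}$ does not hold weakly in $\mathcal M$, but for some constant $\mathsf C>0$ the inequality $\mathcal L r\le\frac{\mathsf C}{r}$ holds weakly in $\mathcal M$. Here $\mathcal L r\le h$ weakly means $-\int_{\mathcal M}\nabla r\cdot\nabla\varphi\,d\mu\le\int_{\mathcal M} h\,\varphi\,d\mu$ for all $0\le\varphi\in C_c^\infty(\mathcal M)$. (e) For every real $p\ge\frac{d+2}{d-2}$ there is $C>0$ such that for every $\ell>0$ there is a smooth, positive function $u$ on $\mathcal M$, depending only on $r$, with $-\mathcal L u=u^p$ in $\mathcal M$ and 1. $u(o)=\ell$; 2. $u$ is strictly decreasing along every non-constant geodesic starting from $o$; 3. $\nabla f\cdot\nabla u>0$ in $\mathcal M\setminus\{o\}$; 4. $u(x)\le\left(\dfrac{1}{C\,r(x)^2+\ell^{1-p}}\right)^{\frac1{p-1}}$ for all $x\in\mathcal M$. -/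

import Mathlib

open scoped Manifold ContDiff ENNReal

noncomputable section

namespace WeightedModel

/-- The smooth manifold `ℝ^d`, with its standard (boundaryless, non-compact) smooth structure. -/
abbrev Space (d : ℕ) : Type := EuclideanSpace ℝ (Fin d)

/-- Smooth Riemannian metrics on the manifold `ℝ^d` (in general not the Euclidean one). -/
abbrev SmoothMetric (d : ℕ) : Type :=
  Bundle.ContMDiffRiemannianMetric 𝓘(ℝ, Space d) ∞ (Space d)
    (fun x : Space d => TangentSpace 𝓘(ℝ, Space d) x)

/-- The `i`-th coordinate vector field. -/
def coordVec {d : ℕ} (i : Fin d) : Space d := EuclideanSpace.single i 1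

/-- The partial derivative `∂_i h`. -/
def pd {d : ℕ} (i : Fin d) (h : Space d → ℝ) (x : Space d) : ℝ :=
  fderiv ℝ h x (coordVec i)

variable {d : ℕ} (g : SmoothMetric d)

/-- The inner product `g_x(v, w)` of two tangent vectors at `x`. -/
def ip (x v w : Space d) : ℝ :=
  (g.inner x : Space d →L[ℝ] Space d →L[ℝ] ℝ) v w

/-! ### Coordinate expressions of the metric, the connection and the curvature -/

/-- The matrix `g_{ij}` of the metric. -/
def gram (x : Space d) : Matrix (Fin d) (Fin d) ℝ :=
  Matrix.of fun i j => ip g x (coordVec i) (coordVec j)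

/-- The matrix `g^{ij}`, inverse of `g_{ij}`. -/
def cogram (x : Space d) : Matrix (Fin d) (Fin d) ℝ := (gram g x)⁻¹

/-- The Christoffel symbol `Γ^k_{ij}` of the Levi-Civita connection. -/
def christoffel (k i j : Fin d) (x : Space d) : ℝ :=
  (1 / 2) * ∑ l, cogram g x k l *
    (pd i (fun y => gram g y j l) x + pd j (fun y => gram g y i l) x
      - pd l (fun y => gram g y i j) x)

/-- The component `Ric_{ij}` of the Ricci tensor (positive on round spheres). -/
def ricci (i j : Fin d) (x : Space d) : ℝ :=
  (∑ k, (pd k (christoffel g k i j) x - pd j (christoffel g k i k) x))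
    + ∑ k, ∑ l, (christoffel g k k l x * christoffel g l i j x
      - christoffel g k j l x * christoffel g l i k x)

/-- The component `(∇² h)_{ij}` of the Hessian of `h`. -/
def hess (h : Space d → ℝ) (i j : Fin d) (x : Space d) : ℝ :=
  pd i (pd j h) x - ∑ k, christoffel g k i j x * pd k h x

/-- The Riemannian gradient `∇h`. -/
def grad (h : Space d → ℝ) (x : Space d) : Space d :=
  WithLp.toLp 2 fun k => ∑ l, cogram g x k l * pd l h x

/-- The Laplace-Beltrami operator `Δ h`, the trace of the Hessian. -/
def laplacian (h : Space d → ℝ) (x : Space d) : ℝ :=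
  ∑ i, ∑ j, cogram g x i j * hess g h i j x

/-- The weighted Laplacian `ℒ h = Δ h - ∇f · ∇h`. -/
def weightedLaplacian (f h : Space d → ℝ) (x : Space d) : ℝ :=
  laplacian g h x - ip g x (grad g f x) (grad g h x)

/-- The `∞`-Bakry-Émery Ricci tensor `Ric_{∞,d} = Ric + ∇² f`, evaluated on `v, w` at `x`. -/
def ricInfty (f : Space d → ℝ) (x v w : Space d) : ℝ :=
  ∑ i, ∑ j, (ricci g i j x + hess g f i j x) * v i * w j

/-! ### Distance, completeness, geodesics, weighted measure -/

/-- The Riemannian (extended) distance: the infimum of the `g`-lengths of `C^1` paths. -/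
def geodEDist (x y : Space d) : ℝ≥0∞ :=
  @Manifold.riemannianEDist (Space d) _ _ (Space d) _ 𝓘(ℝ, Space d) (Space d) _ _
    (fun z => ⟨fun v => ENNReal.ofReal √(ip g z v v)⟩) x y

/-- The Riemannian distance as a real number. -/
def geodDist (x y : Space d) : ℝ := (geodEDist g x y).toReal

/-- Completeness: Cauchy sequences for the Riemannian distance converge. -/
def IsCompleteMetric : Prop :=
  ∀ s : ℕ → Space d,
    (∀ ε : ℝ≥0∞, 0 < ε → ∃ N, ∀ m ≥ N, ∀ n ≥ N, geodEDist g (s m) (s n) < ε) →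
    ∃ y, Filter.Tendsto (fun n => geodEDist g (s n) y) Filter.atTop (nhds 0)

/-- `γ` is a geodesic on the time interval `I`, with velocity field `v`: `γ' = v` and
`v' + Γ(v, v) = 0`. -/
def IsGeodesicOn (γ v : ℝ → Space d) (I : Set ℝ) : Prop :=
  ∀ t ∈ I, HasDerivWithinAt γ (v t) I t ∧
    ∀ k, HasDerivWithinAt (fun s => v s k)
      (-∑ i, ∑ j, christoffel g k i j (γ t) * v t i * v t j) I t

/-- The weighted measure `e^{-f} dν`, where `dν = √(det g_{ij}) dx` is the Riemannian volume. -/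
def weightedMeasure (f : Space d → ℝ) : MeasureTheory.Measure (Space d) :=
  MeasureTheory.volume.withDensity
    fun x => ENNReal.ofReal (Real.exp (-f x) * √(gram g x).det)

/-- The open geodesic ball of centre `o` and radius `R`. -/
def geodBall (o : Space d) (R : ℝ) : Set (Space d) :=
  {x | geodEDist g o x < ENNReal.ofReal R}

/-- `ℒ w ≤ h` weakly on the whole manifold, for a locally Lipschitz function `w`:
`-∫ ∇w · ∇φ dμ ≤ ∫ h φ dμ` for every test function `φ ≥ 0`. It is used below only for
`w = dist(·, o)` and `h = c / dist(·, o)` in dimension at least three, where all integrands are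
integrable; `∇w` exists almost everywhere. -/
def WeakLaplacianLE (f w h : Space d → ℝ) : Prop :=
  ∀ φ : Space d → ℝ, ContDiff ℝ ∞ φ → HasCompactSupport φ → (∀ x, 0 ≤ φ x) →
    -∫ x, ip g x (grad g w x) (grad g φ x) ∂(weightedMeasure g f)
      ≤ ∫ x, h x * φ x ∂(weightedMeasure g f)

/-- The comparison `ℒ(dist(·, o)) ≤ c / dist(·, o)` weakly on the whole manifold. -/
def LaplacianComparison (f : Space d → ℝ) (o : Space d) (c : ℝ) : Prop :=
  WeakLaplacianLE g f (geodDist g o) (fun x => c / geodDist g o x)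

/-! ### Rotational symmetry -/

/-- `g` is a model metric with pole `0`: in polar coordinates `x = r θ`, `r > 0`, `θ ∈ S^{d-1}`,
it is `dr² + ψ(r)² dθ²`, where `ψ` is smooth, `ψ^{(2k)}(0) = 0` for all `k`, `ψ'(0) = 1` and
`ψ' > 0`. At `x = r θ` one has `dr(v) = ⟪x, v⟫ / r` and
`dθ²(v, w) = (⟪v, w⟫ - dr(v) dr(w)) / r²`, with the Euclidean inner product. -/
def IsModelMetric : Prop :=
  ∃ ψ : ℝ → ℝ, ContDiff ℝ ∞ ψ ∧ (∀ k : ℕ, iteratedDeriv (2 * k) ψ 0 = 0) ∧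
    deriv ψ 0 = 1 ∧ (∀ r : ℝ, 0 < r → 0 < deriv ψ r) ∧
    ∀ x : Space d, x ≠ 0 → ∀ v w : Space d,
      ip g x v w =
        (inner ℝ x v / ‖x‖) * (inner ℝ x w / ‖x‖)
          + ψ ‖x‖ ^ 2 *
            ((inner ℝ v w - (inner ℝ x v / ‖x‖) * (inner ℝ x w / ‖x‖)) / ‖x‖ ^ 2)

/-- `h` depends only on the geodesic distance from `o`. -/
def IsRadial (o : Space d) (h : Space d → ℝ) : Prop :=
  ∃ H : ℝ → ℝ, ∀ x, h x = H (geodDist g o x)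

end WeightedModel

end

noncomputable section

namespace WeightedModel

/-! The metric is $(|dx|^2+(x\cdot dx)^2)/(1+|x|^2)$, that is $dr^2+\psi^2d\theta^2$ with
$\psi=r/\sqrt{1+r^2}$. It is Euclidean in radial directions, so the distance to the pole is $|x|$,
and its positive curvature leaves room for a weight whose Hessian is not positive. The potential is
$f=-\frac{d-1}2\log(1+r^2)+(1+r^2)^{-1/2}$. Its logarithm cancels $\sqrt{\det
g}=(1+r^2)^{-(d-1)/2}$, so $\mu$ has Lebesgue density $b=\exp(-(1+r^2)^{-1/2})\in[e^{-1},1)$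
(`exp_neg_potential_mul_sqrt_det`). Euclidean volume growth is then immediate. With $A=r^{d-1}b$ one
gets $\mathcal L r=A'/A=\frac{d-1}r+\frac r{(1+r^2)^{3/2}}$, which exceeds $\frac{d-1}r$ but not
$\frac dr$. The second term of $f$ makes $b$ increase, and is small enough to keep both eigenvalues
of $\mathrm{Ric}+\nabla^2f$, radial and tangential, positive (`ricInfty_potential`).

On radial functions $\mathcal L u=A^{-1}(Au')'$, so the equation reads $-Au'=\int_0^rAu^p$. In the
variable $s=r^2$, after the substitution $\rho=r\theta$, it is a Volterra equation without
singularity at the pole. With the power truncated to $[0,\ell]$ it has a global solution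
(`exists_volterra_solution`), which is nonincreasing with value $\ell$ at the pole; hence the
truncation is inactive as long as the solution is positive.

Positivity is a Pohozaev argument (`radial_solution_pos`). Let $V=\int_0^rA$, $q=-u'$ and
$P=V\big(\frac{q^2}2+\frac{u^{p+1}}{p+1}\big)-\frac{Aqu}{p+1}$. Then
$P'=q^2\big(A(\frac12+\frac1{p+1})-VA'/A\big)$, which is nonpositive because $VA'\ge(1-\frac1d)A^2$
(`area_le_ballVolume`) and $\frac12+\frac1{p+1}\le1-\frac1d$ exactly when $p\ge\frac{d+2}{d-2}$. But
$P(0)=0$, while $P=Vq^2/2>0$ at a first zero of $u$.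

Monotonicity of $u$ and the bounds on $b$ turn the integral equation into $U'\le-cU^p$ in the
variable $s$, which integrates to the decay estimate. Smoothness, including at the pole, is a
bootstrap: $\nabla u$ is $x$ times an integral of $bu^p$ over dilations, and Euler's identity for
that integral is the equation. -/

theorem one_add_norm_sq_pos {E : Type*} [NormedAddCommGroup E] (x : E) : 0 < 1 + ‖x‖ ^ 2 := by
  positivity

/-! ### The bilinear form of the metric. -/

section Form

variable {E : Type*} [NormedAddCommGroup E] [InnerProductSpace ℝ E]

/-- The Euclidean inner product as an `ℝ`-bilinear form. -/
def euclideanForm (E : Type*) [NormedAddCommGroup E] [InnerProductSpace ℝ E] :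
    E →L[ℝ] E →L[ℝ] ℝ := innerSL ℝ

theorem euclideanForm_apply (v w : E) : (euclideanForm E) v w = inner ℝ v w := rfl

/-- The bilinear form `(v, w) ↦ (⟪v, w⟫ + ⟪x, v⟫⟪x, w⟫) / (1 + ‖x‖²)`. -/
def cigarForm (x : E) : E →L[ℝ] E →L[ℝ] ℝ :=
  (1 + ‖x‖ ^ 2)⁻¹ • ((euclideanForm E) + ((euclideanForm E) x).smulRight ((euclideanForm E) x))

theorem cigarForm_apply (x v w : E) :
    cigarForm x v w = (inner ℝ v w + inner ℝ x v * inner ℝ x w) / (1 + ‖x‖ ^ 2) := by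
  simp [cigarForm, euclideanForm_apply]; ring

theorem norm_sq_div_le_cigarForm (x v : E) :
    ‖v‖ ^ 2 / (1 + ‖x‖ ^ 2) ≤ cigarForm x v v := by
  rw [cigarForm_apply, real_inner_self_eq_norm_sq]
  gcongr
  nlinarith [mul_self_nonneg (inner ℝ x v)]

/-- Cauchy–Schwarz, with equality in the radial direction: this makes straight segments through the
pole minimizing. -/
theorem cigarForm_le_norm_sq (x v : E) : cigarForm x v v ≤ ‖v‖ ^ 2 := by
  rw [cigarForm_apply, real_inner_self_eq_norm_sq, div_le_iff₀ (one_add_norm_sq_pos x)]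
  have h := real_inner_mul_inner_self_le x v
  simp only [real_inner_self_eq_norm_sq] at h
  nlinarith

theorem contDiff_cigarForm : ContDiff ℝ ∞ (cigarForm (E := E)) := by
  unfold cigarForm
  have h1 : ContDiff ℝ ∞ fun x : E => (euclideanForm E) x :=
    ((euclideanForm E)).contDiff
  have h2 : ContDiff ℝ ∞ fun x : E => (1 + ‖x‖ ^ 2)⁻¹ :=
    (contDiff_const.add (contDiff_norm_sq ℝ)).inv fun x => (one_add_norm_sq_pos x).ne'
  have h3 : ContDiff ℝ ∞ fun x : E => (euclideanForm E x).smulRight (euclideanForm E x) :=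
    h1.smulRight h1
  have h4 : ContDiff ℝ ∞ fun x : E =>
      euclideanForm E + (euclideanForm E x).smulRight (euclideanForm E x) :=
    contDiff_const.add h3
  have : IsBoundedSMul ℝ (E →L[ℝ] E →L[ℝ] ℝ) :=
    NormedSpace.toIsBoundedSMul (𝕜 := ℝ) (E := E →L[ℝ] E →L[ℝ] ℝ)
  exact h2.smul h4

theorem cigarForm_comm (x v w : E) : cigarForm x v w = cigarForm x w v := by
  rw [cigarForm_apply, cigarForm_apply, real_inner_comm, mul_comm (inner ℝ x v)]

theorem cigarForm_pos (x v : E) (hv : v ≠ 0) : 0 < cigarForm x v v := by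
  have h : 0 < ‖v‖ := norm_pos_iff.2 hv
  exact lt_of_lt_of_le (by positivity) (norm_sq_div_le_cigarForm x v)

theorem isVonNBounded_cigarForm (x : E) :
    Bornology.IsVonNBounded ℝ {v : E | cigarForm x v v < 1} := by
  refine (NormedSpace.isVonNBounded_ball ℝ (E) (1 + ‖x‖ ^ 2)).subset fun v hv => ?_
  have h := lt_of_le_of_lt (norm_sq_div_le_cigarForm x v) hv
  rw [div_lt_one (one_add_norm_sq_pos x)] at h
  rw [mem_ball_zero_iff]
  nlinarith [norm_nonneg v, sq_nonneg ‖x‖]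

end Form

/-! ### The form as a smooth section, and its matrix. -/

theorem symmL_trivializationAt_apply {d : ℕ} (x y : Space d) (v : Space d) :
    (trivializationAt (Space d) (TangentSpace 𝓘(ℝ, Space d)) x).symmL ℝ y v = v :=
  DFunLike.congr_fun (TangentBundle.symmL_model_space (𝕜 := ℝ) x y) v

/-- On the model space, bilinear forms are read in the canonical trivialization as themselves. -/
theorem inCoordinates_bilin {d : ℕ} (x y : Space d)
    (φ : TangentSpace 𝓘(ℝ, Space d) y →L[ℝ] TangentSpace 𝓘(ℝ, Space d) y →L[ℝ] ℝ) :
    ContinuousLinearMap.inCoordinates (Space d) (fun z : Space d => TangentSpace 𝓘(ℝ, Space d) z)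
      (Space d →L[ℝ] ℝ) (fun z : Space d => TangentSpace 𝓘(ℝ, Space d) z →L[ℝ] ℝ) x y x y φ
      = φ := by
  refine ContinuousLinearMap.ext fun v => ?_
  unfold ContinuousLinearMap.inCoordinates
  rw [ContinuousLinearMap.comp_apply, ContinuousLinearMap.comp_apply]
  refine (congrArg (fun z => Bundle.Trivialization.continuousLinearMapAt ℝ
    (trivializationAt (Space d →L[ℝ] ℝ)
      (fun x => TangentSpace 𝓘(ℝ, Space d) x →L[ℝ] ℝ) x) y (φ z))
    (symmL_trivializationAt_apply x y v)).trans ?_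
  rw [Bundle.Trivialization.continuousLinearMapAt_apply,
    Bundle.Trivialization.linearMapAt_apply, if_pos]
  · refine (congrArg Prod.snd (hom_trivializationAt_apply (σ := RingHom.id ℝ) (F₁ := Space d)
      (E₁ := fun x : Space d => TangentSpace 𝓘(ℝ, Space d) x) (F₂ := ℝ)
      (E₂ := fun _ : Space d => ℝ) x ⟨y, φ v⟩)).trans ?_
    refine ContinuousLinearMap.ext fun w => ?_
    unfold ContinuousLinearMap.inCoordinates
    simp only [ContinuousLinearMap.comp_apply]
    refine (congrArg (fun z => Bundle.Trivialization.continuousLinearMapAt ℝ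
      (trivializationAt ℝ (Bundle.Trivial (Space d) ℝ) x) y (φ v z))
      (symmL_trivializationAt_apply x y w)).trans ?_
    simp
    rfl
  · simp [chartAt_self_eq]

/-- The cigar metric on `ℝ^d`: in polar coordinates `dr² + r² / (1 + r²) dθ²`. -/
def cigarMetric (d : ℕ) : SmoothMetric d where
  inner x := (cigarForm x : Space d →L[ℝ] Space d →L[ℝ] ℝ)
  symm := cigarForm_comm
  pos := cigarForm_pos
  isVonNBounded := isVonNBounded_cigarForm
  contMDiff := by
    intro x
    refine (Bundle.contMDiffAt_section _).2 ?_
    refine (contDiff_cigarForm (E := Space d)).contMDiff.contMDiffAt (x := x)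
      |>.congr_of_eventuallyEq (Filter.Eventually.of_forall fun y => ?_)
    refine (congrArg Prod.snd (hom_trivializationAt_apply (σ := RingHom.id ℝ) (F₁ := Space d)
      (E₁ := fun x : Space d => TangentSpace 𝓘(ℝ, Space d) x) (F₂ := Space d →L[ℝ] ℝ)
      (E₂ := fun x : Space d => TangentSpace 𝓘(ℝ, Space d) x →L[ℝ] ℝ) x
      ⟨y, cigarForm y⟩)).trans ?_
    exact inCoordinates_bilin x y (cigarForm y)

theorem ip_cigarMetric {d : ℕ} (x v w : Space d) :
    ip (cigarMetric d) x v w = (inner ℝ v w + inner ℝ x v * inner ℝ x w) / (1 + ‖x‖ ^ 2) :=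
  cigarForm_apply x v w

theorem gram_cigarMetric {d : ℕ} (x : Space d) (i j : Fin d) :
    gram (cigarMetric d) x i j = ((if i = j then 1 else 0) + x i * x j) / (1 + ‖x‖ ^ 2) := by
  simp [gram, ip_cigarMetric, coordVec, EuclideanSpace.inner_single_right, eq_comm]

theorem norm_sq_eq_sum {d : ℕ} (x : Space d) : ‖x‖ ^ 2 = ∑ i, x i * x i := by
  rw [EuclideanSpace.real_norm_sq_eq]
  exact Finset.sum_congr rfl fun i _ => sq _

theorem inner_eq_sum {d : ℕ} (x y : Space d) : inner ℝ x y = ∑ i, x i * y i := by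
  simp [PiLp.inner_apply, mul_comm]

/-- Sherman–Morrison for a rank-one perturbation of the identity. The inverse is polynomial in $x$.
-/
theorem cogram_cigarMetric {d : ℕ} (x : Space d) (i j : Fin d) :
    cogram (cigarMetric d) x i j = (1 + ‖x‖ ^ 2) * (if i = j then 1 else 0) - x i * x j := by
  have h : cogram (cigarMetric d) x = (1 + ‖x‖ ^ 2) • 1 - Matrix.vecMulVec x x := by
    refine Matrix.inv_eq_right_inv ?_
    have hs := one_add_norm_sq_pos x
    have hg : gram (cigarMetric d) x
        = (1 + ‖x‖ ^ 2)⁻¹ • (1 + Matrix.vecMulVec (x : Fin d → ℝ) x) := by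
      ext i j
      simp [gram_cigarMetric, Matrix.vecMulVec_apply, Matrix.one_apply]
      ring
    have hv : Matrix.vecMulVec (x : Fin d → ℝ) x * Matrix.vecMulVec (x : Fin d → ℝ) x
        = ‖x‖ ^ 2 • Matrix.vecMulVec (x : Fin d → ℝ) x := by
      rw [Matrix.vecMulVec_mul_vecMulVec, norm_sq_eq_sum]
      ext i j
      simp [Matrix.vecMulVec_apply, dotProduct]
      ring
    rw [hg, smul_mul_assoc, add_mul, mul_sub, mul_sub, hv]
    ext i j
    simp
    field_simp
    ring
  rw [h]
  simp [Matrix.vecMulVec_apply, Matrix.one_apply]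

/-- Matrix determinant lemma: $\det(1+xx^T)=1+|x|^2$. -/
theorem det_gram_cigarMetric {d : ℕ} (x : Space d) :
    (gram (cigarMetric d) x).det = (1 + ‖x‖ ^ 2) * ((1 + ‖x‖ ^ 2) ^ d)⁻¹ := by
  have hg : gram (cigarMetric d) x
      = (1 + ‖x‖ ^ 2)⁻¹ • (1 + Matrix.replicateCol Unit (x : Fin d → ℝ)
        * Matrix.replicateRow Unit (x : Fin d → ℝ)) := by
    ext i j
    simp [gram_cigarMetric, Matrix.one_apply, Matrix.mul_apply]
    ring
  rw [hg, Matrix.det_smul, Matrix.det_one_add_replicateCol_mul_replicateRow, norm_sq_eq_sum]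
  simp [dotProduct]
  ring

/-! ### Partial derivatives and contractions of coordinate tensors. -/

theorem hasFDerivAt_coord {d : ℕ} (j : Fin d) (x : Space d) :
    HasFDerivAt (fun y : Space d => y j) (EuclideanSpace.proj j : Space d →L[ℝ] ℝ) x :=
  (EuclideanSpace.proj j : Space d →L[ℝ] ℝ).hasFDerivAt

theorem pd_coord {d : ℕ} (i j : Fin d) (x : Space d) :
    pd i (fun y : Space d => y j) x = if i = j then 1 else 0 := by
  rw [pd, (hasFDerivAt_coord j x).fderiv]
  simp [coordVec, eq_comm]

theorem pd_add {d : ℕ} {i : Fin d} {x : Space d} {F G : Space d → ℝ}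
    (hF : DifferentiableAt ℝ F x) (hG : DifferentiableAt ℝ G x) :
    pd i (fun y => F y + G y) x = pd i F x + pd i G x := by
  simp only [pd, fderiv_fun_add hF hG, add_apply]

theorem pd_sub {d : ℕ} {i : Fin d} {x : Space d} {F G : Space d → ℝ}
    (hF : DifferentiableAt ℝ F x) (hG : DifferentiableAt ℝ G x) :
    pd i (fun y => F y - G y) x = pd i F x - pd i G x := by
  simp only [pd, fderiv_fun_sub hF hG, sub_apply]

theorem pd_mul {d : ℕ} {i : Fin d} {x : Space d} {F G : Space d → ℝ}
    (hF : DifferentiableAt ℝ F x) (hG : DifferentiableAt ℝ G x) :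
    pd i (fun y => F y * G y) x = F x * pd i G x + pd i F x * G x := by
  simp only [pd, fderiv_fun_mul hF hG, add_apply, smul_apply, smul_eq_mul]
  ring

theorem pd_const {d : ℕ} {i : Fin d} {x : Space d} (c : ℝ) :
    pd i (fun _ => c) x = 0 := by
  simp [pd]

theorem pd_radial {d : ℕ} {i : Fin d} {x : Space d} {h : ℝ → ℝ} {h' : ℝ}
    (hh : HasDerivAt h h' (‖x‖ ^ 2)) :
    pd i (fun y => h (‖y‖ ^ 2)) x = 2 * x i * h' := by
  have h1 : HasFDerivAt (fun y : Space d => ‖y‖ ^ 2) (2 • innerSL ℝ x) x :=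
    (hasStrictFDerivAt_norm_sq x).hasFDerivAt
  have h2 : HasFDerivAt (fun y : Space d => h (‖y‖ ^ 2)) (h' • 2 • innerSL ℝ x) x :=
    hh.comp_hasFDerivAt x h1
  rw [pd, h2.fderiv]
  simp [coordVec, EuclideanSpace.inner_single_right]
  ring

/-- The Kronecker symbol with real values. -/
def kron {d : ℕ} (i j : Fin d) : ℝ := if i = j then 1 else 0

theorem kron_self {d : ℕ} (i : Fin d) : kron i i = 1 := by simp [kron]

theorem kron_comm {d : ℕ} (i j : Fin d) : kron i j = kron j i := by simp [kron, eq_comm]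

theorem sum_kron_mul {d : ℕ} (i : Fin d) (Z : Fin d → ℝ) : ∑ l, kron i l * Z l = Z i := by
  simp [kron]

theorem sum_linear_mul {d : ℕ} (x : Space d) (i j : Fin d) (a b c : ℝ) (Z : Fin d → ℝ) :
    ∑ l, (a * kron i l + b * kron j l + c * x l) * Z l = a * Z i + b * Z j + c * ∑ l, x l * Z l := by
  rw [← sum_kron_mul i Z, ← sum_kron_mul j Z, Finset.mul_sum, Finset.mul_sum, Finset.mul_sum,
    ← Finset.sum_add_distrib, ← Finset.sum_add_distrib]
  exact Finset.sum_congr rfl fun l _ => by ring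

/-- By rotational symmetry every trace met below is a combination of these five monomials, so
curvature computations reduce to `ring`. -/
theorem sum_quadratic {d : ℕ} (x : Space d) (i j : Fin d) (a b c e m : ℝ) :
    ∑ k, (a * (x k * x k) + b * (x k * kron i k) + c * (x k * kron j k)
      + e * (kron i k * kron j k) + m)
      = a * ‖x‖ ^ 2 + b * x i + c * x j + e * kron i j + d * m := by
  have hi : ∑ k, x k * kron i k = x i := by
    rw [← sum_kron_mul i x]
    exact Finset.sum_congr rfl fun l _ => mul_comm _ _
  have hj : ∑ k, x k * kron j k = x j := by
    rw [← sum_kron_mul j x]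
    exact Finset.sum_congr rfl fun l _ => mul_comm _ _
  have hij : ∑ k, kron i k * kron j k = kron i j := by
    rw [sum_kron_mul i (kron j), kron_comm]
  simp only [Finset.sum_add_distrib, ← Finset.mul_sum, hi, hj, hij, ← norm_sq_eq_sum]
  simp

theorem sum_coord_mul {d : ℕ} (x : Space d) (i j : Fin d) (a b c : ℝ) :
    ∑ l, x l * (a * x l + b * kron i l + c * kron j l) = a * ‖x‖ ^ 2 + b * x i + c * x j := by
  have h := sum_quadratic x i j a b c 0 0
  rw [mul_zero, zero_mul, add_zero, add_zero] at h
  rw [← h]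
  exact Finset.sum_congr rfl fun l _ => by ring

/-! ### Christoffel symbols and Ricci tensor. -/

theorem cogram_cigarMetric_kron {d : ℕ} (x : Space d) (i j : Fin d) :
    cogram (cigarMetric d) x i j = (1 + ‖x‖ ^ 2) * kron i j - x i * x j :=
  cogram_cigarMetric x i j

theorem sum_cogram_mul {d : ℕ} (x : Space d) (k : Fin d) (Z : Fin d → ℝ) :
    ∑ l, cogram (cigarMetric d) x k l * Z l
      = (1 + ‖x‖ ^ 2) * Z k - x k * ∑ l, x l * Z l := by
  have h := sum_linear_mul x k k (1 + ‖x‖ ^ 2) 0 (-x k) Z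
  rw [zero_mul, add_zero, neg_mul, ← sub_eq_add_neg] at h
  rw [← h]
  exact Finset.sum_congr rfl fun l _ => by rw [cogram_cigarMetric_kron]; ring

theorem pd_coord_kron {d : ℕ} (i j : Fin d) (x : Space d) :
    pd i (fun y : Space d => y j) x = kron i j := pd_coord i j x

theorem differentiableAt_coord {d : ℕ} (j : Fin d) (x : Space d) :
    DifferentiableAt ℝ (fun y : Space d => y j) x := (hasFDerivAt_coord j x).differentiableAt

theorem differentiableAt_radial {d : ℕ} {x : Space d} {h : ℝ → ℝ} {h' : ℝ}
    (hh : HasDerivAt h h' (‖x‖ ^ 2)) : DifferentiableAt ℝ (fun y : Space d => h (‖y‖ ^ 2)) x :=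
  hh.differentiableAt.comp x (contDiff_norm_sq ℝ (n := 1)).contDiffAt.differentiableAt_one

theorem hasDerivAt_one_add_inv {s : ℝ} (hs : 0 < 1 + s) :
    HasDerivAt (fun s : ℝ => (1 + s)⁻¹) (-((1 + s) ^ 2)⁻¹) s := by
  have := ((hasDerivAt_id s).const_add 1).inv hs.ne'
  exact this.congr_deriv (by simp [neg_div])

theorem pd_gram_cigarMetric {d : ℕ} (i j l : Fin d) (x : Space d) :
    pd i (fun y => gram (cigarMetric d) y j l) x
      = (kron i j * x l + x j * kron i l) * (1 + ‖x‖ ^ 2)⁻¹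
        - 2 * x i * (kron j l + x j * x l) * ((1 + ‖x‖ ^ 2) ^ 2)⁻¹ := by
  have hg : (fun y => gram (cigarMetric d) y j l)
      = fun y => (kron j l + y j * y l) * (1 + ‖y‖ ^ 2)⁻¹ := by
    funext y
    rw [gram_cigarMetric, div_eq_mul_inv]
    rfl
  have hd := hasDerivAt_one_add_inv (one_add_norm_sq_pos x)
  have hj := differentiableAt_coord j x
  have hl := differentiableAt_coord l x
  rw [hg, pd_mul ((hj.fun_mul hl).const_add _) (differentiableAt_radial hd), pd_radial hd,
    pd_add (differentiableAt_const _) (hj.fun_mul hl), pd_const, pd_mul hj hl, pd_coord_kron,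
    pd_coord_kron]
  ring

theorem christoffel_cigarMetric {d : ℕ} (k i j : Fin d) (x : Space d) :
    christoffel (cigarMetric d) k i j x
      = (2 + ‖x‖ ^ 2) * ((1 + ‖x‖ ^ 2) ^ 2)⁻¹ * (kron i j * x k)
        - (1 + ‖x‖ ^ 2)⁻¹ * (x i * kron j k + x j * kron i k)
        + ((1 + ‖x‖ ^ 2) ^ 2)⁻¹ * (x i * x j * x k) := by
  have hs := one_add_norm_sq_pos x
  rw [christoffel, sum_cogram_mul]
  -- Collecting the derivatives along $x_l,\delta_{il},\delta_{jl}$ gives the shape contracted by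
  -- `sum_coord_mul`.
  have hZ : ∀ l, pd i (fun y => gram (cigarMetric d) y j l) x
      + pd j (fun y => gram (cigarMetric d) y i l) x
      - pd l (fun y => gram (cigarMetric d) y i j) x
      = (2 * kron i j * (1 + ‖x‖ ^ 2)⁻¹
          + (2 * kron i j - 2 * x i * x j) * ((1 + ‖x‖ ^ 2) ^ 2)⁻¹) * x l
        + (-2 * x j * ((1 + ‖x‖ ^ 2) ^ 2)⁻¹) * kron i l
        + (-2 * x i * ((1 + ‖x‖ ^ 2) ^ 2)⁻¹) * kron j l := by
    intro l
    simp only [pd_gram_cigarMetric]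
    rw [kron_comm j i, kron_comm l i, kron_comm l j]
    ring
  simp only [hZ, sum_coord_mul]
  field_simp
  ring

/-- The derivatives of a field of Christoffel type `P δ_{ij} y_k - Q (y_i δ_{jk} + y_j δ_{ik})
+ S y_i y_j y_k` with radial coefficients. -/
theorem pd_christoffel_form {d : ℕ} (m k i j : Fin d) (x : Space d) {P Q S : ℝ → ℝ}
    {P' Q' S' : ℝ} (hP : HasDerivAt P P' (‖x‖ ^ 2)) (hQ : HasDerivAt Q Q' (‖x‖ ^ 2))
    (hS : HasDerivAt S S' (‖x‖ ^ 2)) :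
    pd m (fun y => P (‖y‖ ^ 2) * (kron i j * y k)
        - Q (‖y‖ ^ 2) * (y i * kron j k + y j * kron i k)
        + S (‖y‖ ^ 2) * (y i * y j * y k)) x
      = 2 * x m * P' * (kron i j * x k) + P (‖x‖ ^ 2) * (kron i j * kron m k)
        - (2 * x m * Q' * (x i * kron j k + x j * kron i k)
          + Q (‖x‖ ^ 2) * (kron m i * kron j k + kron m j * kron i k))
        + (2 * x m * S' * (x i * x j * x k)
          + S (‖x‖ ^ 2) * (kron m i * x j * x k + x i * kron m j * x k
            + x i * x j * kron m k)) := by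
  have hP' := differentiableAt_radial hP
  have hQ' := differentiableAt_radial hQ
  have hS' := differentiableAt_radial hS
  have hi := differentiableAt_coord i x
  have hj := differentiableAt_coord j x
  have hk := differentiableAt_coord k x
  have c : ∀ a : ℝ, DifferentiableAt ℝ (fun _ : Space d => a) x := fun a =>
    differentiableAt_const a
  have h1 := (c (kron i j)).fun_mul hk
  have h2 := (hi.fun_mul (c (kron j k))).fun_add (hj.fun_mul (c (kron i k)))
  have h3 := (hi.fun_mul hj).fun_mul hk
  rw [pd_add ((hP'.fun_mul h1).fun_sub (hQ'.fun_mul h2)) (hS'.fun_mul h3),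
    pd_sub (hP'.fun_mul h1) (hQ'.fun_mul h2), pd_mul hP' h1, pd_mul hQ' h2, pd_mul hS' h3,
    pd_radial hP, pd_radial hQ, pd_radial hS, pd_mul (c _) hk,
    pd_add (hi.fun_mul (c _)) (hj.fun_mul (c _)), pd_mul hi (c _), pd_mul hj (c _),
    pd_mul (hi.fun_mul hj) hk, pd_mul hi hj]
  simp only [pd_const, pd_coord_kron]
  ring

/-- The quadratic part of the curvature. Keeping $P,Q,S$ abstract leaves polynomial identities; the
explicit radial coefficients enter only in `ricci_cigarMetric`. -/
theorem sum_christoffel_form {d : ℕ} (x : Space d) (i j : Fin d) (P Q S : ℝ)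
    (Γ : Fin d → Fin d → Fin d → ℝ)
    (hΓ : ∀ k i j, Γ k i j = P * (kron i j * x k) - Q * (x i * kron j k + x j * kron i k)
      + S * (x i * x j * x k)) :
    ∑ k, ∑ l, (Γ k k l * Γ l i j - Γ k j l * Γ l i k)
      = (P - (d + 1) * Q + S * ‖x‖ ^ 2) * (P * ‖x‖ ^ 2 * kron i j - 2 * Q * (x i * x j)
          + S * ‖x‖ ^ 2 * (x i * x j))
        - (-2 * P * Q * ‖x‖ ^ 2 * kron i j
          + (P ^ 2 - 2 * P * Q + (d + 3) * Q ^ 2 + 2 * P * S * ‖x‖ ^ 2 - 4 * Q * S * ‖x‖ ^ 2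
            + S ^ 2 * (‖x‖ ^ 2) ^ 2) * (x i * x j)) := by
  have hT : ∀ l, ∑ k, Γ k k l = (P - (d + 1) * Q + S * ‖x‖ ^ 2) * x l := by
    intro l
    have h : ∀ k, Γ k k l = (S * x l) * (x k * x k) + (P - Q) * (x k * kron l k)
        + 0 * (x k * kron l k) + 0 * (kron l k * kron l k) + -Q * x l := by
      intro k
      rw [hΓ, kron_self, kron_comm k l]
      ring
    simp only [h, sum_quadratic]
    ring
  have hx : ∀ i j, ∑ l, x l * Γ l i j
      = (P * kron i j + S * (x i * x j)) * ‖x‖ ^ 2 - 2 * Q * (x i * x j) := by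
    intro i j
    have h : ∀ l, Γ l i j = (P * kron i j + S * (x i * x j)) * x l + (-Q * x j) * kron i l
        + (-Q * x i) * kron j l := by
      intro l
      rw [hΓ]
      ring
    simp only [h, sum_coord_mul]
    ring
  have hlin : ∀ k, ∑ l, Γ k j l * Γ l i k = (P * x k) * Γ j i k + (-Q * x j) * Γ k i k
      + (-Q * kron j k + S * (x j * x k)) * ∑ l, x l * Γ l i k := by
    intro k
    rw [← sum_linear_mul x j k _ _ _ fun l => Γ l i k]
    refine Finset.sum_congr rfl fun l _ => ?_
    rw [hΓ k j l, kron_comm k l]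
    ring
  have hq : ∀ k, ∑ l, Γ k j l * Γ l i k
      = (2 * P * S * (x i * x j) - P * Q * kron i j - P * S * (x i * x j) - 3 * Q * S * (x i * x j)
          + S ^ 2 * ‖x‖ ^ 2 * (x i * x j)) * (x k * x k)
        + (P ^ 2 * x j - P * Q * x j + Q ^ 2 * x j + P * S * ‖x‖ ^ 2 * x j) * (x k * kron i k)
        + (-P * Q * x i - Q * S * ‖x‖ ^ 2 * x i + 2 * Q ^ 2 * x i) * (x k * kron j k)
        + (-P * Q * ‖x‖ ^ 2) * (kron i k * kron j k) + Q ^ 2 * (x i * x j) := by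
    intro k
    rw [hlin, hx, hΓ, hΓ, kron_self, kron_comm k j]
    ring
  simp only [Finset.sum_sub_distrib]
  rw [Finset.sum_comm]
  simp only [← Finset.sum_mul, hT]
  simp only [mul_assoc (P - (d + 1) * Q + S * ‖x‖ ^ 2), ← Finset.mul_sum, hx, hq, sum_quadratic]
  ring

/-- The derivative part of the curvature, with the derivatives supplied by `pd_christoffel_form`. -/
theorem sum_pd_christoffel_form {d : ℕ} (x : Space d) (i j : Fin d) (P Q S P' Q' S' : ℝ)
    (D : Fin d → Fin d → Fin d → Fin d → ℝ)
    (hD : ∀ m k i j, D m k i j =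
      2 * x m * P' * (kron i j * x k) + P * (kron i j * kron m k)
        - (2 * x m * Q' * (x i * kron j k + x j * kron i k)
          + Q * (kron m i * kron j k + kron m j * kron i k))
        + (2 * x m * S' * (x i * x j * x k)
          + S * (kron m i * x j * x k + x i * kron m j * x k + x i * x j * kron m k))) :
    ∑ k, (D k k i j - D j k i k)
      = (2 * P' * ‖x‖ ^ 2 + (d - 1) * P + (d - 1) * Q - S * ‖x‖ ^ 2) * kron i j
        + (2 * (d - 1) * Q' - 2 * P' + d * S) * (x i * x j) := by
  have h : ∀ k, D k k i j - D j k i k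
      = (2 * P' * kron i j - S * kron i j) * (x k * x k)
        + (S * x j - 2 * x j * P') * (x k * kron i k)
        + (-2 * x i * Q' - S * x i) * (x k * kron j k)
        + (-Q - P) * (kron i k * kron j k)
        + (P * kron i j + S * (x i * x j) + 2 * x j * Q' * x i + Q * kron i j) := by
    intro k
    rw [hD, hD, kron_self, kron_comm k i, kron_comm k j, kron_comm j i]
    ring
  simp only [h, sum_quadratic]
  ring

theorem ricci_cigarMetric {d : ℕ} (i j : Fin d) (x : Space d) :
    ricci (cigarMetric d) i j x
      = (3 + ((d : ℝ) - 2) * ((‖x‖ ^ 2) ^ 2 + 3 * ‖x‖ ^ 2 + 3)) / (1 + ‖x‖ ^ 2) ^ 3 * kron i j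
        + (3 - ((d : ℝ) - 2) * ‖x‖ ^ 2) / (1 + ‖x‖ ^ 2) ^ 3 * (x i * x j) := by
  have hs := one_add_norm_sq_pos x
  set s := ‖x‖ ^ 2 with hsdef
  have hQ : HasDerivAt (fun s : ℝ => (1 + s)⁻¹) (-((1 + s) ^ 2)⁻¹) s := hasDerivAt_one_add_inv hs
  have hS : HasDerivAt (fun s : ℝ => ((1 + s) ^ 2)⁻¹) (-2 * ((1 + s) ^ 3)⁻¹) s := by
    have h := (hQ.fun_pow 2).congr_deriv (g' := -2 * ((1 + s) ^ 3)⁻¹) (by push_cast; field_simp)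
    simpa only [inv_pow] using h
  have hP : HasDerivAt (fun s : ℝ => (2 + s) * ((1 + s) ^ 2)⁻¹)
      (((1 + s) ^ 2)⁻¹ + (2 + s) * (-2 * ((1 + s) ^ 3)⁻¹)) s := by
    have := ((hasDerivAt_id s).const_add 2).fun_mul hS
    simpa using this
  have hΓ : ∀ k i j : Fin d, christoffel (cigarMetric d) k i j = fun y =>
      (fun s : ℝ => (2 + s) * ((1 + s) ^ 2)⁻¹) (‖y‖ ^ 2) * (kron i j * y k)
        - (fun s : ℝ => (1 + s)⁻¹) (‖y‖ ^ 2) * (y i * kron j k + y j * kron i k)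
        + (fun s : ℝ => ((1 + s) ^ 2)⁻¹) (‖y‖ ^ 2) * (y i * y j * y k) := fun k i j =>
    funext fun y => christoffel_cigarMetric k i j y
  have hpd : ∀ m k i j : Fin d, pd m (christoffel (cigarMetric d) k i j) x = _ := fun m k i j =>
    (congrArg (fun F => pd m F x) (hΓ k i j)).trans (pd_christoffel_form m k i j x hP hQ hS)
  simp only [← hsdef] at hpd
  have h1 := sum_pd_christoffel_form x i j _ _ _ _ _ _ _ hpd
  have h2 := sum_christoffel_form x i j _ _ _
    (fun k i j => christoffel (cigarMetric d) k i j x) fun k i j => christoffel_cigarMetric k i j x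
  rw [ricci, h1, h2, ← hsdef]
  field_simp
  ring

/-! ### Hessian, Laplacian and gradient of radial functions. -/

theorem sum_christoffel_mul_coord {d : ℕ} (i j : Fin d) (x : Space d) :
    ∑ k, christoffel (cigarMetric d) k i j x * x k
      = (1 - ((1 + ‖x‖ ^ 2) ^ 2)⁻¹) * kron i j
        - (2 + ‖x‖ ^ 2) * ((1 + ‖x‖ ^ 2) ^ 2)⁻¹ * (x i * x j) := by
  have hs := one_add_norm_sq_pos x
  have h : ∀ k, christoffel (cigarMetric d) k i j x * x k
      = x k * (((2 + ‖x‖ ^ 2) * ((1 + ‖x‖ ^ 2) ^ 2)⁻¹ * kron i j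
          + ((1 + ‖x‖ ^ 2) ^ 2)⁻¹ * (x i * x j)) * x k
        + (-(1 + ‖x‖ ^ 2)⁻¹ * x j) * kron i k + (-(1 + ‖x‖ ^ 2)⁻¹ * x i) * kron j k) := by
    intro k
    rw [christoffel_cigarMetric]
    ring
  simp only [h, sum_coord_mul]
  field_simp
  ring

/-- The Hessian of a function whose gradient is a multiple of the position vector. -/
theorem hess_cigarMetric {d : ℕ} {h k : Space d → ℝ} (hk : ∀ j y, pd j h y = y j * k y)
    {x : Space d} (hkd : DifferentiableAt ℝ k x) (i j : Fin d) :
    hess (cigarMetric d) h i j x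
      = ((1 + ‖x‖ ^ 2) ^ 2)⁻¹ * k x * kron i j
        + (2 + ‖x‖ ^ 2) * ((1 + ‖x‖ ^ 2) ^ 2)⁻¹ * k x * (x i * x j) + x j * pd i k x := by
  have h1 : pd j h = fun y => y j * k y := funext (hk j)
  have h2 : ∑ l, christoffel (cigarMetric d) l i j x * pd l h x
      = (∑ l, christoffel (cigarMetric d) l i j x * x l) * k x := by
    rw [Finset.sum_mul]
    exact Finset.sum_congr rfl fun l _ => by rw [hk]; ring
  rw [hess, h2, sum_christoffel_mul_coord, h1, pd_mul (differentiableAt_coord j x) hkd,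
    pd_coord_kron]
  ring

/-- This is $h''+(d-1)\frac{\psi'}{\psi}h'$ with $h'=rk$ and $\psi'/\psi=1/(r(1+r^2))$, in a form
that is regular at the pole. -/
theorem laplacian_cigarMetric {d : ℕ} {h k : Space d → ℝ} (hk : ∀ j y, pd j h y = y j * k y)
    {x : Space d} (hkd : DifferentiableAt ℝ k x) :
    laplacian (cigarMetric d) h x
      = (1 + (d - 1) * (1 + ‖x‖ ^ 2)⁻¹) * k x + ∑ i, x i * pd i k x := by
  have hs := one_add_norm_sq_pos x
  have h1 : ∀ i, ∑ j, cogram (cigarMetric d) x i j * hess (cigarMetric d) h i j x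
      = ((2 + ‖x‖ ^ 2) * ((1 + ‖x‖ ^ 2) ^ 2)⁻¹ * k x - ((1 + ‖x‖ ^ 2) ^ 2)⁻¹ * k x) * (x i * x i)
        + 0 * (x i * kron i i) + 0 * (x i * kron i i)
        + 0 * (kron i i * kron i i)
        + ((1 + ‖x‖ ^ 2)⁻¹ * k x) + x i * pd i k x := by
    intro i
    have h2 : ∑ j, x j * hess (cigarMetric d) h i j x
        = ((((1 + ‖x‖ ^ 2) ^ 2)⁻¹ + (2 + ‖x‖ ^ 2) * ((1 + ‖x‖ ^ 2) ^ 2)⁻¹ * ‖x‖ ^ 2) * k x * x i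
          + ‖x‖ ^ 2 * pd i k x) := by
      have h3 : ∀ j, x j * hess (cigarMetric d) h i j x
          = x j * (((2 + ‖x‖ ^ 2) * ((1 + ‖x‖ ^ 2) ^ 2)⁻¹ * k x * x i + pd i k x) * x j
            + (((1 + ‖x‖ ^ 2) ^ 2)⁻¹ * k x) * kron i j + 0 * kron i j) := by
        intro j
        rw [hess_cigarMetric hk hkd]
        ring
      simp only [h3, sum_coord_mul]
      ring
    rw [sum_cogram_mul, h2, hess_cigarMetric hk hkd, kron_self]
    field_simp
    ring
  simp only [laplacian, h1, zero_mul, add_zero, Finset.sum_add_distrib, ← Finset.mul_sum,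
    ← norm_sq_eq_sum]
  simp only [Finset.sum_const, Finset.card_univ, Fintype.card_fin, nsmul_eq_mul]
  field_simp
  ring

/-- The position vector is an eigenvector of $g^{ij}$ with eigenvalue $1$, so radial gradients are
the Euclidean ones. -/
theorem sum_cogram_mul_coord {d : ℕ} (x : Space d) (k : Fin d) (c : ℝ) :
    ∑ l, cogram (cigarMetric d) x k l * (x l * c) = x k * c := by
  rw [sum_cogram_mul]
  simp only [← mul_assoc, ← Finset.sum_mul, ← norm_sq_eq_sum]
  ring

theorem grad_cigarMetric {d : ℕ} {h : Space d → ℝ} {x : Space d} {k : ℝ}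
    (hk : ∀ j, pd j h x = x j * k) : grad (cigarMetric d) h x = k • x := by
  ext i
  simp only [grad, hk, sum_cogram_mul_coord]
  simp [mul_comm]

theorem ip_smul_smul_cigarMetric {d : ℕ} (x : Space d) (a b : ℝ) :
    ip (cigarMetric d) x (a • x) (b • x) = a * b * ‖x‖ ^ 2 := by
  have hs := one_add_norm_sq_pos x
  simp only [ip_cigarMetric, inner_smul_left, inner_smul_right, real_inner_self_eq_norm_sq,
    conj_trivial]
  field_simp

theorem ip_grad_cigarMetric {d : ℕ} (x : Space d) (a : ℝ) (h : Space d → ℝ) :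
    ip (cigarMetric d) x (a • x) (grad (cigarMetric d) h x) = a * ∑ l, x l * pd l h x := by
  have hs := one_add_norm_sq_pos x
  have h1 : inner ℝ x (grad (cigarMetric d) h x) = ∑ l, x l * pd l h x := by
    have h2 : ∀ k, x k * ∑ l, cogram (cigarMetric d) x k l * pd l h x
        = (1 + ‖x‖ ^ 2) * (x k * pd k h x) - (∑ l, x l * pd l h x) * (x k * x k) := by
      intro k
      rw [sum_cogram_mul]
      ring
    simp only [inner_eq_sum, grad, h2, Finset.sum_sub_distrib, ← Finset.mul_sum,
      ← norm_sq_eq_sum]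
    ring
  simp only [ip_cigarMetric, inner_smul_left, inner_smul_right, real_inner_self_eq_norm_sq,
    conj_trivial, h1]
  field_simp

/-! ### Distances and completeness. -/

theorem ip_smul_self {d : ℕ} (g : SmoothMetric d) (x : Space d) (r : ℝ) (v : Space d) :
    ip g x (r • v) (r • v) = r ^ 2 * ip g x v v := by
  have h : ∀ B : Space d →L[ℝ] Space d →L[ℝ] ℝ, B (r • v) (r • v) = r ^ 2 * B v v := by
    intro B
    simp only [map_smul, smul_apply, smul_eq_mul]
    ring
  exact h _

theorem ofReal_sqrt_ip_smul {d : ℕ} (g : SmoothMetric d) (x : Space d) (r : ℝ) (v : Space d) :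
    ENNReal.ofReal √(ip g x (r • v) (r • v)) = ‖r‖ₑ * ENNReal.ofReal √(ip g x v v) := by
  rw [ip_smul_self, Real.sqrt_mul (sq_nonneg r), Real.sqrt_sq_eq_abs,
    ENNReal.ofReal_mul (abs_nonneg r), Real.enorm_eq_ofReal_abs]

/-- The Riemannian distance is bounded by the Euclidean one for metrics below the Euclidean one. -/
theorem geodEDist_le_edist {d : ℕ} {g : SmoothMetric d}
    (hg : ∀ x v : Space d, ip g x v v ≤ ‖v‖ ^ 2) (x y : Space d) :
    geodEDist g x y ≤ edist x y := by
  let _ : ∀ z : Space d, ENorm (TangentSpace 𝓘(ℝ, Space d) z) :=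
    fun z => ⟨fun v => ENNReal.ofReal √(ip g z v v)⟩
  have _ : ∀ z : Space d, ENormSMulClass ℝ (TangentSpace 𝓘(ℝ, Space d) z) := fun z =>
    ⟨fun r v => ofReal_sqrt_ip_smul g z r v⟩
  let γ := ContinuousAffineMap.lineMap (R := ℝ) x y
  have h : Manifold.riemannianEDist 𝓘(ℝ, Space d) x y
      ≤ Manifold.pathELength 𝓘(ℝ, Space d) γ 0 1 := by
    apply Manifold.riemannianEDist_le_pathELength ?_
      (by simp [γ, ContinuousAffineMap.coe_lineMap_eq])
      (by simp [γ, ContinuousAffineMap.coe_lineMap_eq]) zero_le_one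
    rw [contMDiffOn_iff_contDiffOn]
    exact γ.contDiff.contDiffOn
  refine h.trans ?_
  rw [Manifold.pathELength_eq_lintegral_mfderivWithin_Icc, ← lintegral_fderiv_lineMap_eq_edist]
  refine MeasureTheory.lintegral_mono fun t => ?_
  rw [mfderivWithin_eq_fderivWithin]
  change ENNReal.ofReal √(ip g _ _ _) ≤ _
  rw [← ofReal_norm]
  exact ENNReal.ofReal_le_ofReal (Real.sqrt_le_left (norm_nonneg _) |>.2 (hg _ _))

/-- Maps whose differential is a contraction for the Riemannian norm contract distances. -/
theorem edist_le_geodEDist {d : ℕ} {g : SmoothMetric d} {F : Type*} [NormedAddCommGroup F]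
    [NormedSpace ℝ F] {Φ : Space d → F} (hΦ : ContDiff ℝ 1 Φ)
    (hg : ∀ x v : Space d, ‖fderiv ℝ Φ x v‖ ^ 2 ≤ ip g x v v) (x y : Space d) :
    edist (Φ x) (Φ y) ≤ geodEDist g x y := by
  let _ : ∀ z : Space d, ENorm (TangentSpace 𝓘(ℝ, Space d) z) :=
    fun z => ⟨fun v => ENNReal.ofReal √(ip g z v v)⟩
  refine le_of_forall_gt fun r hr => ?_
  obtain ⟨γ, rfl, rfl, hγ, hlt⟩ :=
    Manifold.exists_lt_of_riemannianEDist_lt (I := 𝓘(ℝ, Space d)) (x := x) (y := y) (r := r) hr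
  refine lt_of_le_of_lt ?_ hlt
  rw [contMDiffOn_iff_contDiffOn] at hγ
  rw [edist_comm, edist_eq_enorm_sub]
  refine (enorm_sub_le_lintegral_derivWithin_Icc_of_contDiffOn_Icc
    (f := Φ ∘ γ) (hΦ.comp_contDiffOn hγ) zero_le_one).trans ?_
  rw [Manifold.pathELength_eq_lintegral_mfderivWithin_Icc]
  refine MeasureTheory.setLIntegral_mono' measurableSet_Icc fun t ht => ?_
  rw [mfderivWithin_eq_fderivWithin]
  change _ ≤ ENNReal.ofReal √(ip g (γ t) _ _)
  rw [← ofReal_norm]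
  refine ENNReal.ofReal_le_ofReal (Real.le_sqrt_of_sq_le ?_)
  have h1 : DifferentiableWithinAt ℝ γ (Set.Icc 0 1) t :=
    (hγ t ht).differentiableWithinAt one_ne_zero
  have h2 := ((hΦ.differentiable one_ne_zero) (γ t)).hasFDerivAt.comp_hasDerivWithinAt t
    h1.hasDerivWithinAt
  rw [h2.derivWithin (uniqueDiffOn_Icc zero_lt_one t ht)]
  exact hg _ _

theorem hasFDerivAt_norm_sq {d : ℕ} (x : Space d) :
    HasFDerivAt (fun y : Space d => ‖y‖ ^ 2) (2 • innerSL ℝ x) x :=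
  (hasStrictFDerivAt_norm_sq x).hasFDerivAt

theorem hasFDerivAt_sqrt_add_norm_sq {d : ℕ} {a : ℝ} (ha : 0 < a) (x : Space d) :
    HasFDerivAt (fun y : Space d => √(a + ‖y‖ ^ 2)) ((√(a + ‖x‖ ^ 2))⁻¹ • innerSL ℝ x) x := by
  have h := ((hasFDerivAt_norm_sq x).const_add a).sqrt (by positivity)
  refine h.congr_fderiv ?_
  ext v
  simp
  ring

theorem contDiff_sqrt_add_norm_sq {d : ℕ} {a : ℝ} (ha : 0 < a) {n : WithTop ℕ∞} :
    ContDiff ℝ n fun y : Space d => √(a + ‖y‖ ^ 2) :=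
  (contDiff_const.add (contDiff_norm_sq ℝ)).sqrt fun x => by positivity

/-- These functions are smooth at the pole and approximate $|x|$ as $a\to0$. By Cauchy–Schwarz their
differentials have $g$-norm at most $1$. -/
theorem edist_sqrt_add_norm_sq_le {d : ℕ} {a : ℝ} (ha : 0 < a) (x y : Space d) :
    edist √(a + ‖x‖ ^ 2) √(a + ‖y‖ ^ 2) ≤ geodEDist (cigarMetric d) x y := by
  refine edist_le_geodEDist (Φ := fun y : Space d => √(a + ‖y‖ ^ 2))
    (contDiff_sqrt_add_norm_sq ha) (fun x v => ?_) x y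
  rw [(hasFDerivAt_sqrt_add_norm_sq ha x).fderiv, ip_cigarMetric, real_inner_self_eq_norm_sq]
  have hs := one_add_norm_sq_pos x
  have hc : inner ℝ x v * inner ℝ x v ≤ ‖x‖ ^ 2 * ‖v‖ ^ 2 := by
    simpa only [real_inner_self_eq_norm_sq] using real_inner_mul_inner_self_le x v
  have ha' : 0 < a + ‖x‖ ^ 2 := by positivity
  simp only [smul_apply, innerSL_apply_apply, smul_eq_mul, norm_mul, norm_inv, mul_pow, inv_pow,
    Real.norm_eq_abs, sq_abs, Real.sq_sqrt ha'.le]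
  rw [inv_mul_eq_div, div_le_div_iff₀ ha' hs]
  nlinarith [mul_nonneg ha.le (mul_self_nonneg (inner ℝ x v)), mul_nonneg ha.le (sq_nonneg ‖v‖)]

theorem cigarMetric_le {d : ℕ} (x v : Space d) : ip (cigarMetric d) x v v ≤ ‖v‖ ^ 2 :=
  cigarForm_le_norm_sq x v

/-- The segment gives the upper bound; the lower bound is the limit $a\to0$ of $\sqrt{a+|x|^2}-\sqrt
a$. -/
theorem geodEDist_zero_cigarMetric {d : ℕ} (x : Space d) :
    geodEDist (cigarMetric d) 0 x = ENNReal.ofReal ‖x‖ := by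
  apply le_antisymm
  · refine (geodEDist_le_edist cigarMetric_le 0 x).trans_eq ?_
    rw [edist_dist, dist_zero_left]
  · have hlim : Filter.Tendsto (fun a : ℝ => ENNReal.ofReal (√(a + ‖x‖ ^ 2) - √a))
        (nhdsWithin 0 (Set.Ioi 0)) (nhds (ENNReal.ofReal ‖x‖)) := by
      have hc : Continuous fun a : ℝ => ENNReal.ofReal (√(a + ‖x‖ ^ 2) - √a) :=
        ENNReal.continuous_ofReal.comp (by fun_prop)
      have h0 := hc.tendsto 0
      simp only [zero_add, Real.sqrt_zero, sub_zero, Real.sqrt_sq (norm_nonneg x)] at h0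
      exact h0.mono_left nhdsWithin_le_nhds
    refine le_of_tendsto hlim ?_
    filter_upwards [self_mem_nhdsWithin] with a ha
    have h := edist_sqrt_add_norm_sq_le ha 0 x
    rw [edist_comm, edist_dist, Real.dist_eq] at h
    refine le_trans (ENNReal.ofReal_le_ofReal ?_) h
    simp [le_abs_self]

theorem geodDist_zero_cigarMetric {d : ℕ} (x : Space d) :
    geodDist (cigarMetric d) 0 x = ‖x‖ := by
  rw [geodDist, geodEDist_zero_cigarMetric, ENNReal.toReal_ofReal (norm_nonneg x)]

/-- Together with $\sqrt{1+|x|^2}$ this contraction recovers $x$ as a product, which is what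
completeness needs. -/
theorem edist_normalized_le {d : ℕ} (x y : Space d) :
    edist ((√(1 + ‖x‖ ^ 2))⁻¹ • x) ((√(1 + ‖y‖ ^ 2))⁻¹ • y) ≤ geodEDist (cigarMetric d) x y := by
  refine edist_le_geodEDist (Φ := fun y : Space d => (√(1 + ‖y‖ ^ 2))⁻¹ • y) ?_ (fun x v => ?_) x y
  · exact ((contDiff_sqrt_add_norm_sq one_pos).inv fun x => by positivity).smul contDiff_id
  · have hs := one_add_norm_sq_pos x
    have hw : √(1 + ‖x‖ ^ 2) ^ 2 = 1 + ‖x‖ ^ 2 := Real.sq_sqrt hs.le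
    have hw0 : 0 < √(1 + ‖x‖ ^ 2) := by positivity
    have h1 := (hasDerivAt_inv hw0.ne').comp_hasFDerivAt x
      (hasFDerivAt_sqrt_add_norm_sq one_pos x)
    have h2 := h1.smul (hasFDerivAt_id x)
    have h3 : fderiv ℝ (fun y : Space d => (√(1 + ‖y‖ ^ 2))⁻¹ • y) x v
        = (√(1 + ‖x‖ ^ 2))⁻¹ • (v - (inner ℝ x v / (1 + ‖x‖ ^ 2)) • x) := by
      rw [show fderiv ℝ (fun y : Space d => (√(1 + ‖y‖ ^ 2))⁻¹ • y) x = _ from h2.fderiv]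
      simp [smul_sub, smul_smul, hw]
      rw [← sub_eq_add_neg]
      congr 2
      ring
    rw [h3, norm_smul, mul_pow, norm_inv, Real.norm_eq_abs, inv_pow, sq_abs, hw,
      @norm_sub_sq_real, norm_smul, inner_smul_right, mul_pow, Real.norm_eq_abs, sq_abs,
      ip_cigarMetric, real_inner_self_eq_norm_sq, inv_mul_eq_div]
    refine div_le_div_of_nonneg_right ?_ hs.le
    rw [real_inner_comm x v]
    have h4 : (inner ℝ x v / (1 + ‖x‖ ^ 2)) ^ 2 * ‖x‖ ^ 2
        ≤ inner ℝ x v / (1 + ‖x‖ ^ 2) * inner ℝ x v := by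
      rw [div_pow, div_mul_eq_mul_div, div_mul_eq_mul_div, div_le_div_iff₀ (by positivity) hs]
      nlinarith [mul_nonneg (mul_self_nonneg (inner ℝ x v)) hs.le]
    have h5 : 0 ≤ inner ℝ x v / (1 + ‖x‖ ^ 2) * inner ℝ x v := by
      rw [div_mul_eq_mul_div]
      exact div_nonneg (mul_self_nonneg _) hs.le
    nlinarith [mul_self_nonneg (inner ℝ x v)]

theorem isCompleteMetric_cigarMetric (d : ℕ) : IsCompleteMetric (cigarMetric d) := by
  intro s hs
  have key : ∀ {F : Type} [NormedAddCommGroup F] [CompleteSpace F] (Φ : Space d → F),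
      (∀ x y, edist (Φ x) (Φ y) ≤ geodEDist (cigarMetric d) x y) →
      ∃ z, Filter.Tendsto (fun n => Φ (s n)) Filter.atTop (nhds z) := by
    intro F _ _ Φ hΦ
    refine cauchySeq_tendsto_of_complete (EMetric.cauchySeq_iff.2 fun ε hε => ?_)
    obtain ⟨N, hN⟩ := hs ε hε
    exact ⟨N, fun m hm n hn => (hΦ _ _).trans_lt (hN m hm n hn)⟩
  obtain ⟨a, ha⟩ := key (fun x => √(1 + ‖x‖ ^ 2)) (edist_sqrt_add_norm_sq_le one_pos)
  obtain ⟨b, hb⟩ := key (fun x => (√(1 + ‖x‖ ^ 2))⁻¹ • x) edist_normalized_le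
  -- The Euclidean limit is the product of the limits of the two contractions; since $g$ lies below
  -- the Euclidean metric, it is also the limit for the Riemannian distance.
  refine ⟨a • b, ?_⟩
  have h : Filter.Tendsto s Filter.atTop (nhds (a • b)) := by
    refine (ha.smul hb).congr fun n => ?_
    rw [smul_smul, mul_inv_cancel₀ (by positivity), one_smul]
  refine tendsto_of_tendsto_of_tendsto_of_le_of_le tendsto_const_nhds
    (tendsto_iff_edist_tendsto_0.1 h) (fun _ => bot_le) fun n => geodEDist_le_edist cigarMetric_le _ _

/-! ### Polar form of the metric and geodesics from the pole. -/

theorem isModelMetric_cigarMetric (d : ℕ) : IsModelMetric (cigarMetric d) := by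
  have hpos : ∀ r : ℝ, 0 < 1 + r ^ 2 := fun r => by positivity
  have hder : ∀ r : ℝ, HasDerivAt (fun r : ℝ => r / √(1 + r ^ 2)) ((√(1 + r ^ 2) ^ 3)⁻¹) r := by
    intro r
    have h0 : 0 < √(1 + r ^ 2) := Real.sqrt_pos.2 (hpos r)
    have h1 : HasDerivAt (fun r : ℝ => √(1 + r ^ 2)) (r / √(1 + r ^ 2)) r := by
      refine (((hasDerivAt_pow 2 r).const_add 1).sqrt (hpos r).ne').congr_deriv ?_
      field_simp
      simp
    refine ((hasDerivAt_id r).div h1 h0.ne').congr_deriv ?_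
    have h2 := Real.sq_sqrt (hpos r).le
    simp only [id]
    field_simp
    linarith
  refine ⟨fun r => r / √(1 + r ^ 2), ?_, fun k => ?_, ?_, fun r _ => ?_, fun x hx v w => ?_⟩
  · exact contDiff_id.div ((contDiff_const.add (contDiff_id.pow 2)).sqrt fun r => (hpos r).ne')
      fun r => (Real.sqrt_pos.2 (hpos r)).ne'
  -- The profile $r/\sqrt{1+r^2}$ is odd, which kills its even derivatives at $0$.
  · have hodd : (fun r : ℝ => (fun r : ℝ => r / √(1 + r ^ 2)) (-r))
        = -fun r : ℝ => r / √(1 + r ^ 2) := by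
      funext r
      simp [neg_div]
    have h := iteratedDeriv_comp_neg (2 * k) (fun r : ℝ => r / √(1 + r ^ 2)) 0
    rw [hodd, iteratedDeriv_neg] at h
    simp at h
    linarith
  · rw [(hder 0).deriv]
    simp
  · rw [(hder r).deriv]
    have := hpos r
    positivity
  · have hx' : ‖x‖ ≠ 0 := norm_ne_zero_iff.2 hx
    have hs := one_add_norm_sq_pos x
    simp only [ip_cigarMetric, div_pow, Real.sq_sqrt hs.le]
    field_simp
    ring

/-- Along a geodesic the second derivative of $|\gamma|^2/2$ is $|v|^2-\gamma\cdot\Gamma(v,v)$; this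
evaluates the second term. -/
theorem sum_coord_mul_christoffel {d : ℕ} (x v : Space d) :
    ∑ k, x k * ∑ i, ∑ j, christoffel (cigarMetric d) k i j x * v i * v j
      = (1 - ((1 + ‖x‖ ^ 2) ^ 2)⁻¹) * ‖v‖ ^ 2
        - (2 + ‖x‖ ^ 2) * ((1 + ‖x‖ ^ 2) ^ 2)⁻¹ * (∑ k, x k * v k) ^ 2 := by
  have h1 : ∑ k, x k * ∑ i, ∑ j, christoffel (cigarMetric d) k i j x * v i * v j
      = ∑ i, ∑ j, (∑ k, christoffel (cigarMetric d) k i j x * x k) * (v i * v j) := by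
    simp only [Finset.mul_sum, Finset.sum_mul]
    rw [Finset.sum_comm]
    refine Finset.sum_congr rfl fun i _ => ?_
    rw [Finset.sum_comm]
    exact Finset.sum_congr rfl fun j _ => Finset.sum_congr rfl fun k _ => by ring
  have h2 : ∀ i, ∑ j, (∑ k, christoffel (cigarMetric d) k i j x * x k) * (v i * v j)
      = (1 - ((1 + ‖x‖ ^ 2) ^ 2)⁻¹) * (v i * v i)
        - (2 + ‖x‖ ^ 2) * ((1 + ‖x‖ ^ 2) ^ 2)⁻¹ * (∑ k, x k * v k) * (x i * v i) := by
    intro i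
    have h3 : ∀ j, (∑ k, christoffel (cigarMetric d) k i j x * x k) * (v i * v j)
        = (1 - ((1 + ‖x‖ ^ 2) ^ 2)⁻¹) * v i * (kron i j * v j)
          - (2 + ‖x‖ ^ 2) * ((1 + ‖x‖ ^ 2) ^ 2)⁻¹ * (x i * v i) * (x j * v j) := by
      intro j
      rw [sum_christoffel_mul_coord]
      ring
    simp only [h3, Finset.sum_sub_distrib, ← Finset.mul_sum, sum_kron_mul]
    ring
  simp only [h1, h2, Finset.sum_sub_distrib, ← Finset.mul_sum, ← norm_sq_eq_sum]
  ring

/-- Geodesics issued from the pole move strictly away from it. -/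
theorem IsGeodesicOn.strictMonoOn_norm_sq {d : ℕ} {γ v : ℝ → Space d} {T : ℝ}
    (h : IsGeodesicOn (cigarMetric d) γ v (Set.Icc 0 T)) (h0 : γ 0 = 0) (hv : v 0 ≠ 0) :
    StrictMonoOn (fun t => ‖γ t‖ ^ 2) (Set.Icc 0 T) := by
  set y : ℝ → ℝ := fun t => ∑ k, γ t k * v t k with hy
  have hγ : ∀ t ∈ Set.Icc 0 T, ∀ k,
      HasDerivWithinAt (fun s => γ s k) (v t k) (Set.Icc 0 T) t := fun t ht k =>
    (hasFDerivAt_coord k (γ t)).comp_hasDerivWithinAt t (h t ht).1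
  have hsq : ∀ t ∈ Set.Icc 0 T,
      HasDerivWithinAt (fun t => ‖γ t‖ ^ 2) (2 * y t) (Set.Icc 0 T) t := by
    intro t ht
    have h1 := HasDerivWithinAt.fun_sum (u := Finset.univ) fun k _ =>
      (hγ t ht k).fun_mul (hγ t ht k)
    simp only [← norm_sq_eq_sum] at h1
    refine h1.congr_deriv ?_
    rw [hy, Finset.mul_sum]
    exact Finset.sum_congr rfl fun k _ => by ring
  -- The right side is nonnegative: $|x|^2$ is convex along geodesics.
  have hyd : ∀ t ∈ Set.Icc 0 T, HasDerivWithinAt y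
      (((1 + ‖γ t‖ ^ 2) ^ 2)⁻¹ * ‖v t‖ ^ 2
        + (2 + ‖γ t‖ ^ 2) * ((1 + ‖γ t‖ ^ 2) ^ 2)⁻¹ * y t ^ 2) (Set.Icc 0 T) t := by
    intro t ht
    have h1 := HasDerivWithinAt.fun_sum (u := Finset.univ) fun k _ =>
      (hγ t ht k).fun_mul ((h t ht).2 k)
    refine h1.congr_deriv ?_
    simp only [mul_neg, Finset.sum_add_distrib, Finset.sum_neg_distrib,
      sum_coord_mul_christoffel, ← norm_sq_eq_sum]
    ring
  have hynn : ∀ t, 0 ≤ ((1 + ‖γ t‖ ^ 2) ^ 2)⁻¹ * ‖v t‖ ^ 2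
        + (2 + ‖γ t‖ ^ 2) * ((1 + ‖γ t‖ ^ 2) ^ 2)⁻¹ * y t ^ 2 := fun t => by positivity
  have hmono : MonotoneOn y (Set.Icc 0 T) := by
    refine monotoneOn_of_hasDerivWithinAt_nonneg (convex_Icc 0 T)
      (fun t ht => (hyd t ht).continuousWithinAt)
      (fun t ht => (hyd t (interior_subset ht)).mono interior_subset) fun t _ => hynn t
  have hpos : ∀ t ∈ Set.Ioc 0 T, 0 < y t := by
    intro t ht
    by_contra hle
    have hy0 : y 0 = 0 := by simp [hy, h0]
    have h0T : (0 : ℝ) ∈ Set.Icc 0 T := ⟨le_rfl, ht.1.le.trans ht.2⟩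
    have hsub : Set.Icc 0 t ⊆ Set.Icc 0 T := Set.Icc_subset_Icc_right ht.2
    -- As $y$ is nondecreasing from $0$, a value $y(t)\le0$ makes it vanish on $[0,t]$,
    -- contradicting its one-sided derivative $|v(0)|^2$ at $0$.
    have hz : ∀ s ∈ Set.Icc 0 t, y s = 0 := fun s hs =>
      le_antisymm ((hmono (hsub hs) ⟨ht.1.le, ht.2⟩ hs.2).trans (not_lt.1 hle))
        (hy0 ▸ hmono h0T (hsub hs) hs.1)
    have h1 := (hyd 0 h0T).mono hsub
    have h2 : HasDerivWithinAt y 0 (Set.Icc 0 t) 0 :=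
      (hasDerivWithinAt_const (0 : ℝ) _ (0 : ℝ)).congr hz (hz 0 ⟨le_rfl, ht.1.le⟩)
    have h3 := (uniqueDiffOn_Icc ht.1 0 ⟨le_rfl, ht.1.le⟩).eq_deriv _ h1 h2
    rw [h0, hy0] at h3
    simp at h3
    exact hv h3
  refine strictMonoOn_of_deriv_pos (convex_Icc 0 T)
    (fun t ht => (hsq t ht).continuousWithinAt) fun t ht => ?_
  rw [interior_Icc] at ht
  rw [((hsq t ⟨ht.1.le, ht.2.le⟩).hasDerivAt (Icc_mem_nhds ht.1 ht.2)).deriv]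
  exact mul_pos two_pos (hpos t ⟨ht.1, ht.2.le⟩)

/-! ### The potential and the positivity of the weighted Ricci tensor. -/

/-- The logarithmic density `f` of the weight `e^{-f}`, as a function of `‖x‖²`. -/
def potentialProfile (d : ℕ) (s : ℝ) : ℝ := -((d - 1) / 2) * Real.log (1 + s) + (√(1 + s))⁻¹

/-- The potential `f`. -/
def potential (d : ℕ) (x : Space d) : ℝ := potentialProfile d (‖x‖ ^ 2)

/-- The coefficient in `∂_j f = x_j potentialSlope`, as a function of `‖x‖²`. -/
def potentialSlope (d : ℕ) (s : ℝ) : ℝ := -(d - 1) * (1 + s)⁻¹ - (√(1 + s) ^ 3)⁻¹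

theorem hasDerivAt_sqrt_one_add {s : ℝ} (hs : 0 < 1 + s) :
    HasDerivAt (fun s : ℝ => √(1 + s)) (2 * √(1 + s))⁻¹ s := by
  simpa using ((hasDerivAt_id s).const_add 1).sqrt hs.ne'

theorem hasDerivAt_inv_sqrt_one_add {s : ℝ} (hs : 0 < 1 + s) :
    HasDerivAt (fun s : ℝ => (√(1 + s))⁻¹) (-(√(1 + s) ^ 3)⁻¹ / 2) s := by
  have h0 : 0 < √(1 + s) := Real.sqrt_pos.2 hs
  refine ((hasDerivAt_sqrt_one_add hs).fun_inv h0.ne').congr_deriv ?_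
  field_simp

theorem hasDerivAt_potentialProfile {d : ℕ} {s : ℝ} (hs : 0 < 1 + s) :
    HasDerivAt (potentialProfile d) (potentialSlope d s / 2) s := by
  have h1 := (((hasDerivAt_id s).const_add 1).log hs.ne').const_mul (-(((d : ℝ) - 1) / 2))
  refine (h1.fun_add (hasDerivAt_inv_sqrt_one_add hs)).congr_deriv ?_
  simp only [potentialSlope, id]
  ring

theorem hasDerivAt_potentialSlope {d : ℕ} {s : ℝ} (hs : 0 < 1 + s) :
    HasDerivAt (potentialSlope d)
      ((d - 1) * ((1 + s) ^ 2)⁻¹ + 3 / 2 * (√(1 + s) ^ 5)⁻¹) s := by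
  have h0 : 0 < √(1 + s) := Real.sqrt_pos.2 hs
  have h1 := (hasDerivAt_one_add_inv hs).const_mul (-((d : ℝ) - 1))
  have h2 := ((hasDerivAt_sqrt_one_add hs).fun_pow 3).fun_inv (pow_ne_zero 3 h0.ne')
  refine (h1.fun_sub h2).congr_deriv ?_
  push_cast
  field_simp
  ring

theorem pd_potential {d : ℕ} (j : Fin d) (x : Space d) :
    pd j (potential d) x = x j * potentialSlope d (‖x‖ ^ 2) := by
  have h := pd_radial (i := j) (hasDerivAt_potentialProfile (d := d) (one_add_norm_sq_pos x))
  unfold potential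
  rw [h]
  ring

theorem contDiff_potential (d : ℕ) : ContDiff ℝ ∞ (potential d) := by
  unfold potential potentialProfile
  have h1 : ContDiff ℝ ∞ fun x : Space d => 1 + ‖x‖ ^ 2 :=
    contDiff_const.add (contDiff_norm_sq ℝ)
  have h2 : ∀ x : Space d, 1 + ‖x‖ ^ 2 ≠ 0 := fun x => (one_add_norm_sq_pos x).ne'
  exact (contDiff_const.mul (h1.log h2)).add ((h1.sqrt h2).inv fun x => by positivity)

theorem isRadial_comp_norm_sq {d : ℕ} (H : ℝ → ℝ) :
    IsRadial (cigarMetric d) 0 fun x => H (‖x‖ ^ 2) :=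
  ⟨fun r => H (r ^ 2), fun x => by rw [geodDist_zero_cigarMetric]⟩

theorem sum_sum_quadratic_form {d : ℕ} (x v : Space d) (a b : ℝ) (c : Fin d → Fin d → ℝ)
    (hc : ∀ i j, c i j = a * kron i j + b * (x i * x j)) :
    ∑ i, ∑ j, c i j * v i * v j = a * ‖v‖ ^ 2 + b * inner ℝ x v ^ 2 := by
  have h : ∀ i, ∑ j, c i j * v i * v j = a * (v i * v i) + b * inner ℝ x v * (x i * v i) := by
    intro i
    have h2 : ∀ j, c i j * v i * v j = a * v i * (kron i j * v j) + b * (x i * v i) * (x j * v j) := by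
      intro j
      rw [hc]
      ring
    simp only [h2, Finset.sum_add_distrib, ← Finset.mul_sum, sum_kron_mul, ← inner_eq_sum]
    ring
  simp only [h, Finset.sum_add_distrib, ← Finset.mul_sum, ← inner_eq_sum,
    real_inner_self_eq_norm_sq]
  ring

/-- Positivity of the tangential part of `Ric + ∇² f`. -/
theorem tangential_ricci_pos {D s : ℝ} (hD : 3 ≤ D) (hs : 0 ≤ s) :
    0 < (3 + (D - 2) * (s ^ 2 + 3 * s + 3)) / (1 + s) ^ 3
      + ((1 + s) ^ 2)⁻¹ * (-(D - 1) * (1 + s)⁻¹ - (√(1 + s) ^ 3)⁻¹) := by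
  have h1 : 0 < 1 + s := by linarith
  have hW : 1 ≤ √(1 + s) := Real.one_le_sqrt.2 (by linarith)
  have hW2 : √(1 + s) ^ 2 = 1 + s := Real.sq_sqrt h1.le
  -- The only irrational term is bounded by a rational one, leaving a polynomial inequality.
  have h2 : (√(1 + s) ^ 3)⁻¹ ≤ (1 + s)⁻¹ := by
    exact inv_anti₀ h1 (hW2.symm.trans_le (pow_le_pow_right₀ hW (by norm_num)))
  have h3 : ((1 + s) ^ 2)⁻¹ * (-(D - 1) * (1 + s)⁻¹ - (1 + s)⁻¹)
      ≤ ((1 + s) ^ 2)⁻¹ * (-(D - 1) * (1 + s)⁻¹ - (√(1 + s) ^ 3)⁻¹) :=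
    mul_le_mul_of_nonneg_left (by linarith) (by positivity)
  have h4 : (3 + (D - 2) * (s ^ 2 + 3 * s + 3)) / (1 + s) ^ 3
      + ((1 + s) ^ 2)⁻¹ * (-(D - 1) * (1 + s)⁻¹ - (1 + s)⁻¹)
      = (3 + (D - 2) * (s ^ 2 + 3 * s + 3) - D) / (1 + s) ^ 3 := by
    field_simp
    ring
  have h5 : 0 < 3 + (D - 2) * (s ^ 2 + 3 * s + 3) - D := by
    nlinarith [mul_nonneg (by linarith : 0 ≤ D - 2) (by positivity : 0 ≤ s ^ 2 + 3 * s)]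
  have h6 := div_pos h5 (pow_pos h1 3)
  linarith

/-- Positivity of the radial part of `Ric + ∇² f`. -/
theorem radial_ricci_pos {D s : ℝ} (hD : 3 ≤ D) (hs : 0 ≤ s) :
    0 < ((3 + (D - 2) * (s ^ 2 + 3 * s + 3)) / (1 + s) ^ 3
      + ((1 + s) ^ 2)⁻¹ * (-(D - 1) * (1 + s)⁻¹ - (√(1 + s) ^ 3)⁻¹))
      + s * ((3 - (D - 2) * s) / (1 + s) ^ 3
        + (2 + s) * ((1 + s) ^ 2)⁻¹ * (-(D - 1) * (1 + s)⁻¹ - (√(1 + s) ^ 3)⁻¹)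
        + 2 * ((D - 1) * ((1 + s) ^ 2)⁻¹ + 3 / 2 * (√(1 + s) ^ 5)⁻¹)) := by
  have h1 : 0 < 1 + s := by linarith
  have hW : 1 ≤ √(1 + s) := Real.one_le_sqrt.2 (by linarith)
  have hW2 : √(1 + s) ^ 2 = 1 + s := Real.sq_sqrt h1.le
  have h2 : (√(1 + s) ^ 3)⁻¹ ≤ (1 + s)⁻¹ := by
    exact inv_anti₀ h1 (hW2.symm.trans_le (pow_le_pow_right₀ hW (by norm_num)))
  -- After simplification the $(1+s)^{-3}$ terms cancel; the last summand is nonnegative and can be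
  -- dropped.
  have h3 : ((3 + (D - 2) * (s ^ 2 + 3 * s + 3)) / (1 + s) ^ 3
      + ((1 + s) ^ 2)⁻¹ * (-(D - 1) * (1 + s)⁻¹ - (√(1 + s) ^ 3)⁻¹))
      + s * ((3 - (D - 2) * s) / (1 + s) ^ 3
        + (2 + s) * ((1 + s) ^ 2)⁻¹ * (-(D - 1) * (1 + s)⁻¹ - (√(1 + s) ^ 3)⁻¹)
        + 2 * ((D - 1) * ((1 + s) ^ 2)⁻¹ + 3 / 2 * (√(1 + s) ^ 5)⁻¹))
      = (D - 1) * (2 + s) / (1 + s) ^ 2 - (√(1 + s) ^ 3)⁻¹ + 3 * s * (√(1 + s) ^ 5)⁻¹ := by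
    field_simp
    ring
  have h4 : 0 ≤ 3 * s * (√(1 + s) ^ 5)⁻¹ := by positivity
  have h5 : (1 + s)⁻¹ < (D - 1) * (2 + s) / (1 + s) ^ 2 := by
    rw [inv_eq_one_div, div_lt_div_iff₀ h1 (by positivity)]
    nlinarith [mul_pos h1 h1, mul_nonneg (by linarith : 0 ≤ D - 3) (by positivity : 0 ≤ (2 + s) * (1 + s))]
  rw [h3]
  linarith

/-- The tensor has the form $a\,\delta+b\,x\otimes x$, with Euclidean eigenvalues $a$ (tangential)
and $a+b|x|^2$ (radial), both positive. This holds at the pole too. -/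
theorem ricInfty_potential {d : ℕ} (hd : 3 ≤ d) (x v : Space d) (hv : v ≠ 0) :
    0 < ricInfty (cigarMetric d) (potential d) x v v := by
  have hs := one_add_norm_sq_pos x
  have hslope := hasDerivAt_potentialSlope (d := d) hs
  have hpd := fun i => pd_radial (i := i) hslope
  have hd' : (3 : ℝ) ≤ d := by exact_mod_cast hd
  have hform := sum_sum_quadratic_form x v
    ((3 + ((d : ℝ) - 2) * ((‖x‖ ^ 2) ^ 2 + 3 * ‖x‖ ^ 2 + 3)) / (1 + ‖x‖ ^ 2) ^ 3
      + ((1 + ‖x‖ ^ 2) ^ 2)⁻¹ * potentialSlope d (‖x‖ ^ 2))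
    ((3 - ((d : ℝ) - 2) * ‖x‖ ^ 2) / (1 + ‖x‖ ^ 2) ^ 3
      + (2 + ‖x‖ ^ 2) * ((1 + ‖x‖ ^ 2) ^ 2)⁻¹ * potentialSlope d (‖x‖ ^ 2)
      + 2 * ((d - 1) * ((1 + ‖x‖ ^ 2) ^ 2)⁻¹ + 3 / 2 * (√(1 + ‖x‖ ^ 2) ^ 5)⁻¹))
    (fun i j => ricci (cigarMetric d) i j x + hess (cigarMetric d) (potential d) i j x)
    (fun i j => by
      rw [ricci_cigarMetric, hess_cigarMetric (fun j y => pd_potential j y)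
        (differentiableAt_radial hslope), hpd]
      ring)
  rw [ricInfty, hform]
  have ha := tangential_ricci_pos hd' (sq_nonneg ‖x‖)
  have hab := radial_ricci_pos hd' (sq_nonneg ‖x‖)
  rw [← potentialSlope] at ha hab
  have hv2 : 0 < ‖v‖ ^ 2 := by positivity
  have hcs : inner ℝ x v ^ 2 ≤ ‖x‖ ^ 2 * ‖v‖ ^ 2 := by
    simpa only [real_inner_self_eq_norm_sq, sq (inner ℝ x v)]
      using real_inner_mul_inner_self_le x v
  generalize (3 + ((d : ℝ) - 2) * ((‖x‖ ^ 2) ^ 2 + 3 * ‖x‖ ^ 2 + 3)) / (1 + ‖x‖ ^ 2) ^ 3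
      + ((1 + ‖x‖ ^ 2) ^ 2)⁻¹ * potentialSlope d (‖x‖ ^ 2) = a at ha hab ⊢
  generalize (3 - ((d : ℝ) - 2) * ‖x‖ ^ 2) / (1 + ‖x‖ ^ 2) ^ 3
      + (2 + ‖x‖ ^ 2) * ((1 + ‖x‖ ^ 2) ^ 2)⁻¹ * potentialSlope d (‖x‖ ^ 2)
      + 2 * ((d - 1) * ((1 + ‖x‖ ^ 2) ^ 2)⁻¹ + 3 / 2 * (√(1 + ‖x‖ ^ 2) ^ 5)⁻¹) = b at hab ⊢
  -- For $b\ge0$ the tangential eigenvalue suffices; for $b\le0$ Cauchy–Schwarz bounds the form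
  -- below by the radial one.
  rcases le_total 0 b with hb | hb
  · have := mul_pos ha hv2
    have := mul_nonneg hb (sq_nonneg (inner ℝ x v))
    linarith
  · have h1 := mul_pos hab hv2
    have h2 := mul_le_mul_of_nonpos_left hcs hb
    nlinarith

/-! ### The weighted measure and its volume growth. -/

/-- The density `e^{-f} √(det g)` of the weighted measure, as a function of `‖x‖²`. -/
def density (s : ℝ) : ℝ := Real.exp (-(√(1 + s))⁻¹)

theorem density_pos (s : ℝ) : 0 < density s := Real.exp_pos _

theorem density_le_one (s : ℝ) : density s ≤ 1 :=
  Real.exp_le_one_iff.2 (neg_nonpos.2 (inv_nonneg.2 (Real.sqrt_nonneg _)))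

theorem hasDerivAt_density {s : ℝ} (hs : 0 < 1 + s) :
    HasDerivAt density (density s * ((√(1 + s) ^ 3)⁻¹ / 2)) s := by
  refine (hasDerivAt_inv_sqrt_one_add hs).fun_neg.exp.congr_deriv ?_
  rw [density]
  ring

theorem exp_neg_potential_mul_sqrt_det {d : ℕ} (x : Space d) :
    Real.exp (-potential d x) * √(gram (cigarMetric d) x).det = density (‖x‖ ^ 2) := by
  have hs := one_add_norm_sq_pos x
  have h1 : Real.exp ((d - 1) / 2 * Real.log (1 + ‖x‖ ^ 2)) * √(gram (cigarMetric d) x).det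
      = 1 := by
    have h2 : (Real.exp ((d - 1) / 2 * Real.log (1 + ‖x‖ ^ 2))) ^ 2
        * (gram (cigarMetric d) x).det = 1 := by
      rw [det_gram_cigarMetric, ← Real.exp_nat_mul]
      have h3 : ((2 : ℕ) : ℝ) * ((d - 1) / 2 * Real.log (1 + ‖x‖ ^ 2))
          = d * Real.log (1 + ‖x‖ ^ 2) - Real.log (1 + ‖x‖ ^ 2) := by
        push_cast
        ring
      rw [h3, Real.exp_sub, Real.exp_nat_mul, Real.exp_log hs]
      field_simp
    rw [← Real.sqrt_sq (Real.exp_nonneg ((d - 1) / 2 * Real.log (1 + ‖x‖ ^ 2))),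
      ← Real.sqrt_mul (sq_nonneg _), h2, Real.sqrt_one]
  have h4 : -potential d x = (d - 1) / 2 * Real.log (1 + ‖x‖ ^ 2) + -(√(1 + ‖x‖ ^ 2))⁻¹ := by
    rw [potential, potentialProfile]
    ring
  rw [h4, Real.exp_add, mul_right_comm, h1, one_mul, density]

theorem weightedMeasure_potential (d : ℕ) :
    weightedMeasure (cigarMetric d) (potential d)
      = MeasureTheory.volume.withDensity fun x => ENNReal.ofReal (density (‖x‖ ^ 2)) := by
  simp only [weightedMeasure, exp_neg_potential_mul_sqrt_det]

/-- Balls about the pole are Euclidean and the density is at most $1$, so the Euclidean volume of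
the unit ball serves as constant. -/
theorem weightedMeasure_geodBall_le {d : ℕ} (hd : 3 ≤ d) :
    ∃ C : ℝ, 0 < C ∧ ∀ R : ℝ, 0 < R →
      weightedMeasure (cigarMetric d) (potential d) (geodBall (cigarMetric d) 0 R)
        ≤ ENNReal.ofReal (C * R ^ d) := by
  have : Nonempty (Fin d) := ⟨⟨0, by omega⟩⟩
  have : Nontrivial (Space d) := inferInstance
  have hball : MeasureTheory.volume (Metric.ball (0 : Space d) 1) ≠ ⊤ :=
    MeasureTheory.measure_ball_lt_top.ne
  refine ⟨(MeasureTheory.volume (Metric.ball (0 : Space d) 1)).toReal,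
    ENNReal.toReal_pos (Metric.measure_ball_pos _ _ one_pos).ne' hball, fun R hR => ?_⟩
  have h1 : geodBall (cigarMetric d) 0 R = Metric.ball (0 : Space d) R := by
    ext x
    rw [geodBall, Set.mem_ofPred_eq, geodEDist_zero_cigarMetric, mem_ball_zero_iff,
      ENNReal.ofReal_lt_ofReal_iff hR]
  have h2 : weightedMeasure (cigarMetric d) (potential d) ≤ MeasureTheory.volume := by
    rw [weightedMeasure_potential]
    conv_rhs => rw [← MeasureTheory.withDensity_one (μ := MeasureTheory.volume)]
    refine MeasureTheory.withDensity_mono (Filter.Eventually.of_forall fun x => ?_)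
    exact ENNReal.ofReal_le_one.2 (density_le_one _)
  rw [h1]
  refine (h2 _).trans ?_
  rw [MeasureTheory.Measure.addHaar_ball _ _ hR.le, ENNReal.ofReal_mul ENNReal.toReal_nonneg,
    ENNReal.ofReal_toReal hball, finrank_euclideanSpace_fin, mul_comm]

/-! ### The weak Laplacian of the distance. -/

open MeasureTheory

theorem integral_weightedMeasure_potential {d : ℕ} (F : Space d → ℝ) :
    ∫ x, F x ∂(weightedMeasure (cigarMetric d) (potential d))
      = ∫ x, density (‖x‖ ^ 2) * F x := by
  have hm : Measurable fun x : Space d => ENNReal.ofReal (density (‖x‖ ^ 2)) := by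
    unfold density
    fun_prop
  rw [weightedMeasure_potential, integral_withDensity_eq_integral_toReal_smul hm
    (Filter.Eventually.of_forall fun _ => ENNReal.ofReal_lt_top)]
  simp only [ENNReal.toReal_ofReal (density_pos _).le, smul_eq_mul]

theorem contDiff_density_norm_sq {d : ℕ} {n : WithTop ℕ∞} :
    ContDiff ℝ n fun x : Space d => density (‖x‖ ^ 2) :=
  Real.contDiff_exp.comp
    ((contDiff_sqrt_add_norm_sq one_pos).inv fun x => by positivity).neg

theorem pd_norm {d : ℕ} {x : Space d} (hx : x ≠ 0) (j : Fin d) :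
    pd j (fun y : Space d => ‖y‖) x = x j * ‖x‖⁻¹ := by
  have hs : 0 < ‖x‖ ^ 2 := by positivity
  have h := pd_radial (i := j) (Real.hasDerivAt_sqrt hs.ne')
  simp only [Real.sqrt_sq (norm_nonneg _)] at h
  rw [h]
  field_simp

theorem integral_mul_pd_eq_neg {d : ℕ} {F φ : Space d → ℝ} (hF : ContDiff ℝ 1 F)
    (hφ : ContDiff ℝ 1 φ) (hc : HasCompactSupport φ) (i : Fin d) :
    ∫ x, F x * pd i φ x = -∫ x, pd i F x * φ x := by
  have hpF : Continuous (pd i F) := (hF.continuous_fderiv one_ne_zero).clm_apply continuous_const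
  have hpφ : Continuous (pd i φ) := (hφ.continuous_fderiv one_ne_zero).clm_apply continuous_const
  have hcφ : HasCompactSupport (pd i φ) := hc.fderiv_apply ℝ _
  exact integral_mul_fderiv_eq_neg_fderiv_mul_of_integrable
    ((hpF.mul hφ.continuous).integrable_of_hasCompactSupport hc.mul_left)
    ((hF.continuous.mul hpφ).integrable_of_hasCompactSupport hcφ.mul_left)
    ((hF.continuous.mul hφ.continuous).integrable_of_hasCompactSupport hc.mul_left)
    (fun x _ => hF.differentiable one_ne_zero x) (fun x _ => hφ.differentiable one_ne_zero x)

/-- The divergence theorem for the radial field `k(‖x‖²) x`. -/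
theorem integral_radial_field {d : ℕ} {k k' : ℝ → ℝ} (hk : ContDiff ℝ 1 fun x : Space d => k (‖x‖ ^ 2))
    (hk' : ∀ s, 0 ≤ s → HasDerivAt k (k' s) s)
    {φ : Space d → ℝ} (hφ : ContDiff ℝ 1 φ) (hc : HasCompactSupport φ) :
    ∫ x, k (‖x‖ ^ 2) * ∑ i, x i * pd i φ x
      = -∫ x, (d * k (‖x‖ ^ 2) + 2 * ‖x‖ ^ 2 * k' (‖x‖ ^ 2)) * φ x := by
  have hX : ∀ i : Fin d, ContDiff ℝ 1 fun x : Space d => x i * k (‖x‖ ^ 2) := fun i =>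
    (EuclideanSpace.proj i : Space d →L[ℝ] ℝ).contDiff.mul hk
  have hpd : ∀ (i : Fin d) (x : Space d), pd i (fun x : Space d => x i * k (‖x‖ ^ 2)) x
      = x i * (2 * x i * k' (‖x‖ ^ 2)) + k (‖x‖ ^ 2) := by
    intro i x
    have h := hk' (‖x‖ ^ 2) (sq_nonneg _)
    rw [pd_mul (differentiableAt_coord i x) (differentiableAt_radial h), pd_radial h,
      pd_coord_kron, kron_self, one_mul]
  have hpφ : ∀ i, Continuous (pd i φ) := fun i =>
    (hφ.continuous_fderiv one_ne_zero).clm_apply continuous_const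
  have hcφ : ∀ i, HasCompactSupport (pd i φ) := fun i => hc.fderiv_apply ℝ _
  have hpX : ∀ i : Fin d, Continuous (pd i fun x : Space d => x i * k (‖x‖ ^ 2)) := fun i =>
    ((hX i).continuous_fderiv one_ne_zero).clm_apply continuous_const
  have h1 : ∀ x : Space d, k (‖x‖ ^ 2) * ∑ i, x i * pd i φ x
      = ∑ i, x i * k (‖x‖ ^ 2) * pd i φ x := by
    intro x
    rw [Finset.mul_sum]
    exact Finset.sum_congr rfl fun i _ => by ring
  have h2 : ∀ x : Space d, (d * k (‖x‖ ^ 2) + 2 * ‖x‖ ^ 2 * k' (‖x‖ ^ 2)) * φ x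
      = ∑ i, pd i (fun x : Space d => x i * k (‖x‖ ^ 2)) x * φ x := by
    intro x
    rw [← Finset.sum_mul]
    simp only [hpd, Finset.sum_add_distrib]
    have h3 : ∑ i, x i * (2 * x i * k' (‖x‖ ^ 2)) = 2 * ‖x‖ ^ 2 * k' (‖x‖ ^ 2) := by
      rw [norm_sq_eq_sum, Finset.mul_sum, Finset.sum_mul]
      exact Finset.sum_congr rfl fun i _ => by ring
    rw [h3, Finset.sum_const, Finset.card_univ, Fintype.card_fin, nsmul_eq_mul]
    ring
  simp only [h1, h2]
  rw [integral_finsetSum (f := fun i x => x i * k (‖x‖ ^ 2) * pd i φ x) _ fun i _ =>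
      ((hX i).continuous.mul (hpφ i)).integrable_of_hasCompactSupport (hcφ i).mul_left,
    integral_finsetSum (f := fun i x => pd i (fun x : Space d => x i * k (‖x‖ ^ 2)) x * φ x) _
      fun i _ => ((hpX i).mul hφ.continuous).integrable_of_hasCompactSupport hc.mul_left,
    ← Finset.sum_neg_distrib]
  exact Finset.sum_congr rfl fun i _ => integral_mul_pd_eq_neg (hX i) hφ hc i

/-- In polar coordinates the singularity becomes $r^{d-2}$, which is locally integrable. -/
theorem integrable_mul_inv_norm {d : ℕ} (hd : 3 ≤ d) {φ : Space d → ℝ} (hφ : Continuous φ)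
    (hc : HasCompactSupport φ) : Integrable fun x => φ x * ‖x‖⁻¹ := by
  have : Nonempty (Fin d) := ⟨⟨0, by omega⟩⟩
  have : Nontrivial (Space d) := inferInstance
  obtain ⟨M, hM⟩ := hφ.bounded_above_of_compact_support hc
  obtain ⟨R, hR⟩ := hc.isBounded.subset_ball (0 : Space d)
  have h1 : IntegrableOn (fun x : Space d => M * ‖x‖⁻¹) (Metric.ball 0 R) volume := by
    refine (integrableOn_fun_norm_addHaar volume (f := fun r => M * r⁻¹)).2 ?_
    rw [finrank_euclideanSpace_fin]
    have h2 : IntegrableOn (fun y : ℝ => M * y ^ (d - 2)) (Set.Ioo 0 R) :=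
      ((continuous_const.mul (continuous_pow _)).integrableOn_Icc (a := 0) (b := R)).mono_set
        Set.Ioo_subset_Icc_self
    refine h2.congr_fun (fun y hy => ?_) measurableSet_Ioo
    obtain ⟨m, rfl⟩ : ∃ m, d = m + 2 := ⟨d - 2, by omega⟩
    have hy0 : y ≠ 0 := hy.1.ne'
    simp only [Nat.add_sub_cancel, smul_eq_mul, show m + 2 - 1 = m + 1 by omega]
    field_simp
    ring
  have h2 : Integrable ((Metric.ball (0 : Space d) R).indicator fun x => M * ‖x‖⁻¹) :=
    (integrable_indicator_iff measurableSet_ball).2 h1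
  refine h2.mono' (hφ.measurable.mul measurable_norm.inv).aestronglyMeasurable
    (Filter.Eventually.of_forall fun x => ?_)
  rw [norm_mul, norm_inv, norm_norm]
  by_cases hx : x ∈ Metric.ball (0 : Space d) R
  · rw [Set.indicator_of_mem hx]
    exact mul_le_mul_of_nonneg_right (hM x) (by positivity)
  · have : φ x = 0 := by
      by_contra h
      exact hx (hR (subset_tsupport φ h))
    rw [Set.indicator_of_notMem hx, this]
    simp

/-- The distributional Laplacian of the distance from the pole. -/
theorem integral_density_mul_radial_deriv {d : ℕ} (hd : 3 ≤ d) {φ : Space d → ℝ}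
    (hφ : ContDiff ℝ 1 φ) (hc : HasCompactSupport φ) :
    ∫ x, density (‖x‖ ^ 2) * (‖x‖⁻¹ * ∑ i, x i * pd i φ x)
      = -∫ x, density (‖x‖ ^ 2) * (((d - 1) * ‖x‖⁻¹ + ‖x‖ * (√(1 + ‖x‖ ^ 2) ^ 3)⁻¹) * φ x) := by
  have : Nonempty (Fin d) := ⟨⟨0, by omega⟩⟩
  have : Nontrivial (Space d) := inferInstance
  -- Regularization: $x/|x|$ is replaced by the smooth field $x/\sqrt{a_n+|x|^2}$, to which the
  -- divergence theorem applies across the pole.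
  set a : ℕ → ℝ := fun n => 1 / ((n : ℝ) + 1) with ha
  have ha0 : ∀ n, 0 < a n := fun n => by positivity
  have hlim : Filter.Tendsto a Filter.atTop (nhds 0) := tendsto_one_div_add_atTop_nhds_zero_nat
  set k : ℕ → ℝ → ℝ := fun n s => density s * (√(a n + s))⁻¹ with hk
  set k' : ℕ → ℝ → ℝ := fun n s => density s * ((√(1 + s) ^ 3)⁻¹ / 2) * (√(a n + s))⁻¹
    - density s * ((√(a n + s) ^ 3)⁻¹ / 2) with hk'
  have hder : ∀ n s, 0 ≤ s → HasDerivAt (k n) (k' n s) s := by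
    intro n s hs
    have h0 : 0 < a n + s := by linarith [ha0 n]
    have h1 : HasDerivAt (fun s : ℝ => (√(a n + s))⁻¹) (-((√(a n + s) ^ 3)⁻¹ / 2)) s := by
      have h2 : HasDerivAt (fun s : ℝ => √(a n + s)) (2 * √(a n + s))⁻¹ s := by
        simpa using ((hasDerivAt_id s).const_add (a n)).sqrt h0.ne'
      have h3 := Real.sqrt_pos.2 h0
      refine (h2.fun_inv h3.ne').congr_deriv ?_
      field_simp
    refine ((hasDerivAt_density (by linarith)).fun_mul h1).congr_deriv ?_
    simp only [hk']
    ring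
  have hsm : ∀ n, ContDiff ℝ 1 fun x : Space d => k n (‖x‖ ^ 2) := fun n =>
    contDiff_density_norm_sq.mul ((contDiff_sqrt_add_norm_sq (ha0 n)).inv fun x => by
      have := ha0 n
      positivity)
  have heq := fun n => integral_radial_field (hsm n) (hder n) hφ hc
  have hae : ∀ᵐ x : Space d, x ≠ 0 := by
    simp [ae_iff]
  have hinv : ∀ n (x : Space d), x ≠ 0 → (√(a n + ‖x‖ ^ 2))⁻¹ ≤ ‖x‖⁻¹ := fun n x hx =>
    inv_anti₀ (norm_pos_iff.2 hx) (Real.le_sqrt_of_sq_le (by linarith [ha0 n]))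
  have hsqrt : ∀ x : Space d, x ≠ 0 → Filter.Tendsto (fun n => (√(a n + ‖x‖ ^ 2))⁻¹)
      Filter.atTop (nhds ‖x‖⁻¹) := by
    intro x hx
    have h := (hlim.add_const (‖x‖ ^ 2)).sqrt
    rw [zero_add, Real.sqrt_sq (norm_nonneg x)] at h
    exact h.inv₀ (norm_ne_zero_iff.2 hx)
  have hpφ : ∀ i, Continuous (pd i φ) := fun i =>
    (hφ.continuous_fderiv one_ne_zero).clm_apply continuous_const
  have hcφ : ∀ i, HasCompactSupport (pd i φ) := fun i => hc.fderiv_apply ℝ _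
  have hL : Filter.Tendsto (fun n => ∫ x : Space d, k n (‖x‖ ^ 2) * ∑ i, x i * pd i φ x)
      Filter.atTop
      (nhds (∫ x, density (‖x‖ ^ 2) * (‖x‖⁻¹ * ∑ i, x i * pd i φ x))) := by
    refine tendsto_integral_of_dominated_convergence (fun x => ∑ i, ‖pd i φ x‖) (fun n => ?_)
      (integrable_finsetSum _ fun i _ =>
        ((hpφ i).integrable_of_hasCompactSupport (hcφ i)).norm) (fun n => ?_) ?_
    · refine ((hsm n).continuous.mul (continuous_finsetSum _ fun i _ => ?_)).aestronglyMeasurable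
      exact (EuclideanSpace.proj i : Space d →L[ℝ] ℝ).continuous.mul (hpφ i)
    · filter_upwards [hae] with x hx
      have hx0 : 0 < ‖x‖ := norm_pos_iff.2 hx
      have h1 : ‖k n (‖x‖ ^ 2)‖ ≤ ‖x‖⁻¹ := by
        rw [Real.norm_eq_abs, abs_of_nonneg (mul_nonneg (density_pos _).le (by positivity))]
        calc _ ≤ 1 * ‖x‖⁻¹ := mul_le_mul (density_le_one _) (hinv n x hx) (by positivity) zero_le_one
          _ = _ := one_mul _
      rw [norm_mul]
      have h2 : ‖∑ i, x i * pd i φ x‖ ≤ ‖x‖ * ∑ i, ‖pd i φ x‖ := by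
        rw [Finset.mul_sum]
        refine (norm_sum_le _ _).trans (Finset.sum_le_sum fun i _ => ?_)
        rw [norm_mul]
        exact mul_le_mul_of_nonneg_right (PiLp.norm_apply_le x i) (norm_nonneg _)
      calc _ ≤ ‖x‖⁻¹ * (‖x‖ * ∑ i, ‖pd i φ x‖) := mul_le_mul h1 h2 (norm_nonneg _) (by positivity)
        _ = _ := by field_simp
    · filter_upwards [hae] with x hx
      have h := ((hsqrt x hx).const_mul (density (‖x‖ ^ 2))).mul_const (∑ i, x i * pd i φ x)
      rwa [mul_assoc] at h
  have hR : Filter.Tendsto (fun n => ∫ x : Space d,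
        (d * k n (‖x‖ ^ 2) + 2 * ‖x‖ ^ 2 * k' n (‖x‖ ^ 2)) * φ x) Filter.atTop
      (nhds (∫ x, density (‖x‖ ^ 2)
        * (((d - 1) * ‖x‖⁻¹ + ‖x‖ * (√(1 + ‖x‖ ^ 2) ^ 3)⁻¹) * φ x))) := by
    -- In this form the domination is visible: $(a_n+r^2)^{-1/2}\le r^{-1}$, and the bracket is at
    -- most $d+1$ in absolute value.
    have hform : ∀ n (x : Space d), (d * k n (‖x‖ ^ 2) + 2 * ‖x‖ ^ 2 * k' n (‖x‖ ^ 2)) * φ x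
        = density (‖x‖ ^ 2) * ((√(a n + ‖x‖ ^ 2))⁻¹ * (d + ‖x‖ ^ 2 * (√(1 + ‖x‖ ^ 2) ^ 3)⁻¹
          - ‖x‖ ^ 2 * ((√(a n + ‖x‖ ^ 2))⁻¹) ^ 2) * φ x) := by
      intro n x
      simp only [hk, hk']
      ring
    simp only [hform]
    refine tendsto_integral_of_dominated_convergence (fun x => (d + 1) * ‖φ x * ‖x‖⁻¹‖)
      (fun n => ?_) ((integrable_mul_inv_norm hd hφ.continuous hc).norm.const_mul _)
      (fun n => ?_) ?_
    · have := hφ.continuous.measurable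
      unfold density
      exact Measurable.aestronglyMeasurable (by fun_prop)
    · filter_upwards [hae] with x hx
      have hs := one_add_norm_sq_pos x
      have hx0 : 0 < ‖x‖ := norm_pos_iff.2 hx
      have hW : 1 ≤ √(1 + ‖x‖ ^ 2) := Real.one_le_sqrt.2 (by linarith [sq_nonneg ‖x‖])
      have hW2 : √(1 + ‖x‖ ^ 2) ^ 2 = 1 + ‖x‖ ^ 2 := Real.sq_sqrt hs.le
      have h1 : ‖x‖ ^ 2 * (√(1 + ‖x‖ ^ 2) ^ 3)⁻¹ ≤ 1 := by
        rw [← div_eq_mul_inv, div_le_one (by positivity)]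
        nlinarith [pow_le_pow_right₀ hW (by norm_num : 2 ≤ 3)]
      have h2 : ‖x‖ ^ 2 * ((√(a n + ‖x‖ ^ 2))⁻¹) ^ 2 ≤ 1 := by
        calc _ ≤ ‖x‖ ^ 2 * (‖x‖⁻¹) ^ 2 := mul_le_mul_of_nonneg_left
              (pow_le_pow_left₀ (by positivity) (hinv n x hx) 2) (sq_nonneg _)
          _ = 1 := by field_simp
      have h3 : 0 ≤ ‖x‖ ^ 2 * (√(1 + ‖x‖ ^ 2) ^ 3)⁻¹ := by positivity
      have h4 : 0 ≤ ‖x‖ ^ 2 * ((√(a n + ‖x‖ ^ 2))⁻¹) ^ 2 := by positivity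
      have hd' : (3 : ℝ) ≤ d := by exact_mod_cast hd
      have h5 : ‖(d : ℝ) + ‖x‖ ^ 2 * (√(1 + ‖x‖ ^ 2) ^ 3)⁻¹
          - ‖x‖ ^ 2 * ((√(a n + ‖x‖ ^ 2))⁻¹) ^ 2‖ ≤ d + 1 := by
        rw [Real.norm_eq_abs, abs_le]
        constructor <;> linarith
      have h6 : ‖(√(a n + ‖x‖ ^ 2))⁻¹‖ ≤ ‖x‖⁻¹ := by
        rw [Real.norm_eq_abs, abs_of_nonneg (by positivity)]
        exact hinv n x hx
      have h7 : ‖density (‖x‖ ^ 2)‖ ≤ 1 := by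
        rw [Real.norm_eq_abs, abs_of_pos (density_pos _)]
        exact density_le_one _
      rw [norm_mul, norm_mul, norm_mul, norm_mul, norm_inv ‖x‖, norm_norm]
      calc _ ≤ 1 * (‖x‖⁻¹ * (d + 1) * ‖φ x‖) := by gcongr
        _ = _ := by ring
    · filter_upwards [hae] with x hx
      have hx0 : ‖x‖ ≠ 0 := norm_ne_zero_iff.2 hx
      have h := ((hsqrt x hx).mul ((((hsqrt x hx).pow 2).const_mul (‖x‖ ^ 2)).const_sub
        (d + ‖x‖ ^ 2 * (√(1 + ‖x‖ ^ 2) ^ 3)⁻¹))).mul_const (φ x) |>.const_mul (density (‖x‖ ^ 2))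
      have h1 : ‖x‖⁻¹ * (d + ‖x‖ ^ 2 * (√(1 + ‖x‖ ^ 2) ^ 3)⁻¹ - ‖x‖ ^ 2 * ‖x‖⁻¹ ^ 2)
          = (d - 1) * ‖x‖⁻¹ + ‖x‖ * (√(1 + ‖x‖ ^ 2) ^ 3)⁻¹ := by
        field_simp
        ring
      rwa [h1] at h
  have hL' := hL
  simp only [heq] at hL'
  exact tendsto_nhds_unique hL' hR.neg

theorem integral_ip_grad_geodDist {d : ℕ} (hd : 3 ≤ d) {φ : Space d → ℝ}
    (hφ : ContDiff ℝ 1 φ) (hc : HasCompactSupport φ) :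
    -∫ x, ip (cigarMetric d) x (grad (cigarMetric d) (geodDist (cigarMetric d) 0) x)
        (grad (cigarMetric d) φ x) ∂(weightedMeasure (cigarMetric d) (potential d))
      = ∫ x, density (‖x‖ ^ 2)
        * (((d - 1) * ‖x‖⁻¹ + ‖x‖ * (√(1 + ‖x‖ ^ 2) ^ 3)⁻¹) * φ x) := by
  have : Nonempty (Fin d) := ⟨⟨0, by omega⟩⟩
  have : Nontrivial (Space d) := inferInstance
  have hr : geodDist (cigarMetric d) 0 = fun x => ‖x‖ := funext geodDist_zero_cigarMetric
  rw [neg_eq_iff_eq_neg, ← integral_density_mul_radial_deriv hd hφ hc,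
    integral_weightedMeasure_potential]
  have hae : ∀ᵐ x : Space d, x ≠ 0 := by
    simp [ae_iff]
  refine integral_congr_ae ?_
  filter_upwards [hae] with x hx
  rw [hr, grad_cigarMetric fun j => pd_norm hx j, ip_grad_cigarMetric]

theorem integrable_density_mul_inv_norm {d : ℕ} (hd : 3 ≤ d) {φ : Space d → ℝ}
    (hφ : Continuous φ) (hc : HasCompactSupport φ) (c : ℝ) :
    Integrable fun x => density (‖x‖ ^ 2) * (c * ‖x‖⁻¹ * φ x) := by
  have hρ : Continuous fun x : Space d => density (‖x‖ ^ 2) :=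
    (contDiff_density_norm_sq (n := 0)).continuous
  refine ((integrable_mul_inv_norm hd (hρ.mul hφ) hc.mul_left).const_mul c).congr
    (Filter.Eventually.of_forall fun x => ?_)
  simp only [Pi.mul_apply]
  ring

theorem integrable_density_mul_radial {d : ℕ} {φ : Space d → ℝ}
    (hφ : Continuous φ) (hc : HasCompactSupport φ) :
    Integrable fun x => density (‖x‖ ^ 2) * (‖x‖ * (√(1 + ‖x‖ ^ 2) ^ 3)⁻¹ * φ x) := by
  have hρ : Continuous fun x : Space d => density (‖x‖ ^ 2) :=
    (contDiff_density_norm_sq (n := 0)).continuous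
  have hw : Continuous fun x : Space d => (√(1 + ‖x‖ ^ 2) ^ 3)⁻¹ :=
    Continuous.inv₀ (by fun_prop) fun x => by positivity
  exact (hρ.mul ((continuous_norm.mul hw).mul hφ)).integrable_of_hasCompactSupport
    hc.mul_left.mul_left

theorem laplacianComparison_cigarMetric {d : ℕ} (hd : 3 ≤ d) :
    LaplacianComparison (cigarMetric d) (potential d) 0 d := by
  intro φ hφ hc hnn
  rw [integral_ip_grad_geodDist hd (hφ.of_le (by exact_mod_cast le_top)) hc,
    integral_weightedMeasure_potential]
  have hsplit := (integrable_density_mul_inv_norm hd hφ.continuous hc (d - 1)).add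
    (integrable_density_mul_radial hφ.continuous hc)
  refine integral_mono (hsplit.congr (Filter.Eventually.of_forall fun x => ?_))
    ((integrable_density_mul_inv_norm hd hφ.continuous hc d).congr
      (Filter.Eventually.of_forall fun x => ?_)) fun x => ?_
  · simp only [Pi.add_apply]
    ring
  · simp only [geodDist_zero_cigarMetric, div_eq_mul_inv]
  · simp only [geodDist_zero_cigarMetric, div_eq_mul_inv]
    refine mul_le_mul_of_nonneg_left (mul_le_mul_of_nonneg_right ?_ (hnn x)) (density_pos _).le
    have hs := one_add_norm_sq_pos x
    have hW : 1 ≤ √(1 + ‖x‖ ^ 2) := Real.one_le_sqrt.2 (by linarith [sq_nonneg ‖x‖])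
    have hW2 : √(1 + ‖x‖ ^ 2) ^ 2 = 1 + ‖x‖ ^ 2 := Real.sq_sqrt hs.le
    rcases (norm_nonneg x).eq_or_lt with h | h
    · simp [← h]
    -- The excess over $(d-1)/r$ is at most $1/r$, whence the constant $d$.
    · have h2 : ‖x‖ * (√(1 + ‖x‖ ^ 2) ^ 3)⁻¹ ≤ ‖x‖⁻¹ := by
        rw [← div_eq_mul_inv, inv_eq_one_div, div_le_div_iff₀ (by positivity) h]
        nlinarith [pow_le_pow_right₀ hW (by norm_num : 2 ≤ 3)]
      linarith

/-- The excess $r(1+r^2)^{-3/2}$ is positive off the pole, so its integral against a bump function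
contradicts the comparison. -/
theorem not_laplacianComparison_cigarMetric {d : ℕ} (hd : 3 ≤ d) :
    ¬ LaplacianComparison (cigarMetric d) (potential d) 0 ((d : ℝ) - 1) := by
  intro h
  have : Nonempty (Fin d) := ⟨⟨0, by omega⟩⟩
  let φ : ContDiffBump (0 : Space d) := ⟨1, 2, one_pos, one_lt_two⟩
  have hφ : ContDiff ℝ ∞ φ := φ.contDiff
  have hc := φ.hasCompactSupport
  have h1 := h φ hφ hc fun x => φ.nonneg
  rw [integral_ip_grad_geodDist hd (hφ.of_le (by exact_mod_cast le_top)) hc,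
    integral_weightedMeasure_potential] at h1
  have hA := integrable_density_mul_inv_norm hd hφ.continuous hc (d - 1)
  have hB := integrable_density_mul_radial hφ.continuous hc
  have h2 : ∫ x, density (‖x‖ ^ 2)
      * (((d - 1) * ‖x‖⁻¹ + ‖x‖ * (√(1 + ‖x‖ ^ 2) ^ 3)⁻¹) * φ x)
      = (∫ x, density (‖x‖ ^ 2) * ((d - 1) * ‖x‖⁻¹ * φ x))
        + ∫ x, density (‖x‖ ^ 2) * (‖x‖ * (√(1 + ‖x‖ ^ 2) ^ 3)⁻¹ * φ x) := by
    rw [← integral_add hA hB]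
    exact integral_congr_ae (Filter.Eventually.of_forall fun x => by ring)
  have hpos : 0 < ∫ x, density (‖x‖ ^ 2) * (‖x‖ * (√(1 + ‖x‖ ^ 2) ^ 3)⁻¹ * φ x) := by
    have hρ : Continuous fun x : Space d => density (‖x‖ ^ 2) :=
      (contDiff_density_norm_sq (n := 0)).continuous
    have hw : Continuous fun x : Space d => (√(1 + ‖x‖ ^ 2) ^ 3)⁻¹ :=
      Continuous.inv₀ (by fun_prop) fun x => by positivity
    let e : Space d := EuclideanSpace.single ⟨0, by omega⟩ 1
    have he : ‖e‖ = 1 := by simp [e]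
    refine Continuous.integral_pos_of_hasCompactSupport_nonneg_nonzero (x := e)
      (hρ.mul ((continuous_norm.mul hw).mul hφ.continuous)) hc.mul_left.mul_left (fun x => ?_) ?_
    · exact mul_nonneg (density_pos _).le (mul_nonneg (by positivity) φ.nonneg)
    · have hφe : φ e = 1 := φ.one_of_mem_closedBall (by simp [φ, he])
      simp only [hφe, he]
      have := density_pos (1 ^ 2)
      positivity
  simp only [geodDist_zero_cigarMetric, div_eq_mul_inv] at h1
  linarith

/-! ### Nonlinear Volterra equations on the line. -/

theorem abs_integral_le_exp {f : ℝ → ℝ} (hf : Continuous f) {c a : ℝ} (hc : 0 ≤ c) (ha : 0 < a)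
    (h : ∀ t, |f t| ≤ c * Real.exp (a * |t|)) (s : ℝ) :
    |∫ t in (0 : ℝ)..s, f t| ≤ c / a * Real.exp (a * |s|) := by
  have key : ∀ (f : ℝ → ℝ), Continuous f → (∀ t, |f t| ≤ c * Real.exp (a * |t|)) → ∀ s, 0 ≤ s →
      |∫ t in (0 : ℝ)..s, f t| ≤ c / a * Real.exp (a * |s|) := by
    intro f hf h s hs
    have h1 : ∫ t in (0 : ℝ)..s, c * Real.exp (a * t) = c / a * (Real.exp (a * s) - 1) := by
      have hd : ∀ t ∈ Set.uIcc 0 s, HasDerivAt (fun t => c / a * Real.exp (a * t))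
          (c * Real.exp (a * t)) t := by
        intro t _
        refine ((((hasDerivAt_id t).const_mul a).exp).const_mul (c / a)).congr_deriv ?_
        simp only [id]
        field_simp
      rw [intervalIntegral.integral_eq_sub_of_hasDerivAt hd
        ((by fun_prop : Continuous fun t => c * Real.exp (a * t)).intervalIntegrable _ _)]
      simp
      ring
    rw [abs_of_nonneg hs]
    have h2 : |∫ t in (0 : ℝ)..s, f t| ≤ ∫ t in (0 : ℝ)..s, c * Real.exp (a * t) := by
      rw [← Real.norm_eq_abs]
      refine intervalIntegral.norm_integral_le_of_norm_le hs
        (Filter.Eventually.of_forall fun t ht => ?_)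
        ((by fun_prop : Continuous fun t => c * Real.exp (a * t)).intervalIntegrable _ _)
      have := h t
      rwa [abs_of_nonneg ht.1.le] at this
    refine h2.trans ?_
    rw [h1]
    gcongr
    linarith
  rcases le_total 0 s with hs | hs
  · exact key f hf h s hs
  · have h2 := key (fun t => f (-t)) (hf.comp continuous_neg)
      (fun t => by simpa using h (-t)) (-s) (neg_nonneg.2 hs)
    rw [intervalIntegral.integral_comp_neg, neg_neg, neg_zero, intervalIntegral.integral_symm,
      abs_neg, abs_neg] at h2
    exact h2

theorem exp_neg_mul_le {a b c : ℝ} (h : b ≤ c * Real.exp a) : Real.exp (-a) * b ≤ c := by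
  rw [Real.exp_neg, inv_mul_le_iff₀ (Real.exp_pos a), mul_comm]
  exact h

theorem abs_weighted_sub_integral_le {G : ℝ → ℝ} (hG : Continuous G) {M a : ℝ} (ha : 1 ≤ a)
    (hM : 0 ≤ M) (hb : ∀ t, |G t| ≤ M) (l s : ℝ) :
    |Real.exp (-(a * |s|)) * (l - ∫ t in (0 : ℝ)..s, G t)| ≤ |l| + M := by
  have ha0 : 0 < a := by linarith
  have h1 := abs_integral_le_exp hG hM ha0 (fun t =>
    (hb t).trans (le_mul_of_one_le_right hM (Real.one_le_exp (by positivity)))) s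
  rw [abs_mul, Real.abs_exp]
  refine exp_neg_mul_le ((abs_sub _ _).trans ?_)
  rw [add_mul]
  refine add_le_add (le_mul_of_one_le_right (abs_nonneg l) (Real.one_le_exp (by positivity)))
    (h1.trans ?_)
  exact mul_le_mul_of_nonneg_right (div_le_self hM ha) (Real.exp_pos _).le

/-- In the norm $\sup e^{-a|s|}|\cdot|$ integration gains a factor $1/a$, so a large $a$ makes the
integral operator contract on the whole line at once. -/
theorem abs_weighted_integral_sub_le {G H : ℝ → ℝ} (hG : Continuous G) (hH : Continuous H)
    {c a : ℝ} (ha : 0 < a) (hc : 0 ≤ c) (hb : ∀ t, |G t - H t| ≤ c * Real.exp (a * |t|))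
    (l s : ℝ) :
    |Real.exp (-(a * |s|)) * (l - ∫ t in (0 : ℝ)..s, G t)
      - Real.exp (-(a * |s|)) * (l - ∫ t in (0 : ℝ)..s, H t)| ≤ c / a := by
  have h2 := abs_integral_le_exp (f := fun t => G t - H t) (hG.sub hH) hc ha hb s
  rw [intervalIntegral.integral_sub (hG.intervalIntegrable _ _)
    (hH.intervalIntegrable _ _)] at h2
  rw [← mul_sub, sub_sub_sub_cancel_left, abs_mul, Real.abs_exp, abs_sub_comm]
  exact exp_neg_mul_le h2

/-- Global solvability of nonlinear Volterra equations with a bounded Lipschitz causal operator. -/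
theorem exists_volterra_solution {Φ : (ℝ → ℝ) → ℝ → ℝ} {M K : ℝ} (hM : 0 ≤ M) (hK : 0 ≤ K)
    (hΦc : ∀ U, Continuous U → Continuous (Φ U))
    (hΦb : ∀ U, Continuous U → ∀ t, |Φ U t| ≤ M)
    (hΦL : ∀ U V, Continuous U → Continuous V → ∀ t c,
      (∀ τ, |τ| ≤ |t| → |U τ - V τ| ≤ c) → |Φ U t - Φ V t| ≤ K * c) (l : ℝ) :
    ∃ U : ℝ → ℝ, Continuous U ∧ ∀ s, U s = l - ∫ t in (0 : ℝ)..s, Φ U t := by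
  -- The contraction factor is $K/a<1/2$, and $a\ge1$ also when $K=0$.
  obtain ⟨a, ha⟩ : ∃ a : ℝ, a = 2 * K + 1 := ⟨_, rfl⟩
  have ha1 : 1 ≤ a := by linarith
  have ha0 : 0 < a := by linarith
  have hexp : ∀ c : ℝ, Continuous fun s : ℝ => Real.exp (c * |s|) := fun c => by fun_prop
  have hW : ∀ z : BoundedContinuousFunction ℝ ℝ,
      Continuous fun s => Real.exp (a * |s|) * z s := fun z => (hexp a).mul z.continuous
  have hint : ∀ U, Continuous U → Continuous fun s => ∫ t in (0 : ℝ)..s, Φ U t := fun U hU =>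
    intervalIntegral.continuous_primitive (fun _ _ => (hΦc U hU).intervalIntegrable _ _) 0
  have hS : ∀ U, Continuous U → ∃ T : BoundedContinuousFunction ℝ ℝ, ∀ s,
      T s = Real.exp (-(a * |s|)) * (l - ∫ t in (0 : ℝ)..s, Φ U t) := by
    intro U hU
    refine ⟨BoundedContinuousFunction.ofNormedAddCommGroup
      (fun s => Real.exp (-(a * |s|)) * (l - ∫ t in (0 : ℝ)..s, Φ U t)) ?_ (|l| + M) ?_,
      fun s => rfl⟩
    · exact (by fun_prop : Continuous fun s : ℝ => Real.exp (-(a * |s|))).mul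
        (continuous_const.sub (hint U hU))
    · exact abs_weighted_sub_integral_le (hΦc U hU) ha1 hM (hΦb U hU) l
  choose T hTs using fun z => hS _ (hW z)
  have hT : ContractingWith (1 / 2) T := by
    refine ⟨by norm_num [← NNReal.coe_lt_coe], LipschitzWith.of_dist_le_mul fun z z' => ?_⟩
    refine (BoundedContinuousFunction.dist_le (by positivity)).2 fun s => ?_
    have h1 : ∀ t, |Φ (fun s => Real.exp (a * |s|) * z s) t
        - Φ (fun s => Real.exp (a * |s|) * z' s) t|
        ≤ K * dist z z' * Real.exp (a * |t|) := by
      intro t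
      rw [mul_assoc]
      -- Causality enters here: only $|\tau|\le|t|$ matters, so the weight at $\tau$ is at most the
      -- weight at $t$.
      refine hΦL _ _ (hW z) (hW z') t _ fun τ hτ => ?_
      rw [← mul_sub, abs_mul, Real.abs_exp, mul_comm]
      exact mul_le_mul (z.dist_coe_le_dist τ)
        (Real.exp_le_exp.2 (mul_le_mul_of_nonneg_left hτ ha0.le)) (Real.exp_pos _).le dist_nonneg
    have h2 := abs_weighted_integral_sub_le (hΦc _ (hW z)) (hΦc _ (hW z')) ha0
      (mul_nonneg hK dist_nonneg) h1 l s
    rw [Real.dist_eq, hTs, hTs]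
    refine h2.trans ?_
    rw [div_le_iff₀ ha0]
    have h3 : (0 : ℝ) ≤ dist z z' := dist_nonneg
    norm_num
    nlinarith
  obtain ⟨z, hz⟩ : ∃ z, T z = z := ⟨_, hT.fixedPoint_isFixedPt⟩
  refine ⟨fun s => Real.exp (a * |s|) * z s, hW _, fun s => ?_⟩
  have hfix := hTs z s
  rw [hz] at hfix
  simp only [hfix]
  rw [← mul_assoc, ← Real.exp_add]
  simp

/-! ### The truncated radial equation. -/

/-- The power nonlinearity truncated to `[0, l]`. -/
def truncPow (l p u : ℝ) : ℝ := max 0 (min u l) ^ p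

theorem truncPow_nonneg (l p u : ℝ) : 0 ≤ truncPow l p u :=
  Real.rpow_nonneg (le_max_left _ _) p

theorem truncPow_of_mem {l p u : ℝ} (h0 : 0 ≤ u) (hl : u ≤ l) : truncPow l p u = u ^ p := by
  rw [truncPow, min_eq_left hl, max_eq_right h0]

theorem truncPow_le {l p : ℝ} (hl : 0 ≤ l) (hp : 0 ≤ p) (u : ℝ) : truncPow l p u ≤ l ^ p :=
  Real.rpow_le_rpow (le_max_left _ _) (max_le hl (min_le_right _ _)) hp

theorem continuous_truncPow {l p : ℝ} (hp : 0 ≤ p) : Continuous (truncPow l p) :=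
  (by fun_prop : Continuous fun u : ℝ => max 0 (min u l)).rpow_const fun _ => Or.inr hp

theorem abs_truncPow_sub_le {l p : ℝ} (hl : 0 ≤ l) (hp : 1 ≤ p) (u v : ℝ) :
    |truncPow l p u - truncPow l p v| ≤ p * l ^ (p - 1) * |u - v| := by
  have hmem : ∀ w : ℝ, max 0 (min w l) ∈ Set.Icc 0 l := fun w =>
    ⟨le_max_left _ _, max_le hl (min_le_right _ _)⟩
  have h1 := (convex_Icc 0 l).norm_image_sub_le_of_norm_hasDerivWithin_le
    (f := fun w : ℝ => w ^ p) (f' := fun w => p * w ^ (p - 1)) (C := p * l ^ (p - 1))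
    (fun w _ => (Real.hasDerivAt_rpow_const (Or.inr hp)).hasDerivWithinAt)
    (fun w hw => by
      rw [Real.norm_eq_abs, abs_of_nonneg (mul_nonneg (by linarith) (Real.rpow_nonneg hw.1 _))]
      exact mul_le_mul_of_nonneg_left (Real.rpow_le_rpow hw.1 hw.2 (by linarith)) (by linarith))
    (hmem v) (hmem u)
  refine h1.trans (mul_le_mul_of_nonneg_left ?_ (by positivity))
  rw [Real.norm_eq_abs]
  have h2 := abs_max_sub_max_le_max 0 (min u l) 0 (min v l)
  have h3 := abs_min_sub_min_le_max u l v l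
  rw [sub_self, abs_zero, max_eq_right (abs_nonneg (min u l - min v l))] at h2
  rw [sub_self, abs_zero, max_eq_left (abs_nonneg (u - v))] at h3
  exact h2.trans h3

/-- The density extended by a constant to negative arguments. -/
def extDensity (s : ℝ) : ℝ := density (max s 0)

theorem extDensity_of_nonneg {s : ℝ} (hs : 0 ≤ s) : extDensity s = density s := by
  rw [extDensity, max_eq_left hs]

theorem extDensity_pos (s : ℝ) : 0 < extDensity s := density_pos _

theorem continuous_extDensity : Continuous extDensity := by
  unfold extDensity density
  refine Real.continuous_exp.comp (Continuous.neg (Continuous.inv₀ (by fun_prop) fun s => ?_))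
  have : 0 ≤ max s 0 := le_max_right _ _
  positivity

theorem density_le_density {s t : ℝ} (hs : 0 ≤ s) (h : s ≤ t) : density s ≤ density t := by
  refine Real.exp_le_exp.2 (neg_le_neg (inv_anti₀ (by positivity) (Real.sqrt_le_sqrt ?_)))
  linarith

/-- The density is nondecreasing, so the quotient of densities inside `slope` is at most $1$. -/
theorem extDensity_mul_sq_le (s : ℝ) {θ : ℝ} (h0 : 0 ≤ θ) (h1 : θ ≤ 1) :
    extDensity (s * θ ^ 2) ≤ extDensity s := by
  have h2 : θ ^ 2 ≤ 1 := pow_le_one₀ h0 h1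
  refine density_le_density (le_max_right _ _) (max_le ?_ (le_max_right _ _))
  rcases le_total 0 s with hs | hs
  · exact (mul_le_of_le_one_right hs h2).trans (le_max_left _ _)
  · exact (mul_nonpos_of_nonpos_of_nonneg hs (sq_nonneg θ)).trans (le_max_right _ _)

/-- `-U'` for the solution of the radial equation in the variable `s = r²`. -/
def slope (d : ℕ) (F U : ℝ → ℝ) (s : ℝ) : ℝ :=
  (2 * extDensity s)⁻¹ * ∫ θ in (0 : ℝ)..1, θ ^ (d - 1) * extDensity (s * θ ^ 2) * F (U (s * θ ^ 2))

theorem continuous_slope_integrand (d : ℕ) {F U : ℝ → ℝ} (hF : Continuous F) (hU : Continuous U) :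
    Continuous (Function.uncurry fun s θ : ℝ =>
      θ ^ (d - 1) * extDensity (s * θ ^ 2) * F (U (s * θ ^ 2))) := by
  have h := continuous_extDensity
  simp only [Function.uncurry_def]
  fun_prop

theorem continuous_slope (d : ℕ) {F U : ℝ → ℝ} (hF : Continuous F) (hU : Continuous U) :
    Continuous (slope d F U) := by
  have h1 : Continuous fun s : ℝ => (2 * extDensity s)⁻¹ :=
    (continuous_const.mul continuous_extDensity).inv₀ fun s =>
      (mul_pos two_pos (extDensity_pos s)).ne'
  exact h1.mul (intervalIntegral.continuous_parametric_intervalIntegral_of_continuous'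
    (continuous_slope_integrand d hF hU) 0 1)

/-- Used twice: with $G=F(U)$ for boundedness of `slope`, and with a difference for its Lipschitz
bound. -/
theorem abs_inv_mul_integral_le (d : ℕ) {G : ℝ → ℝ} {s c : ℝ}
    (hG : ∀ θ ∈ Set.Icc (0 : ℝ) 1, |G θ| ≤ c) :
    |(2 * extDensity s)⁻¹ * ∫ θ in (0 : ℝ)..1, θ ^ (d - 1) * extDensity (s * θ ^ 2) * G θ|
      ≤ c := by
  have hs := extDensity_pos s
  have hc : 0 ≤ c := (abs_nonneg _).trans (hG 0 ⟨le_rfl, zero_le_one⟩)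
  have h1 : |∫ θ in (0 : ℝ)..1, θ ^ (d - 1) * extDensity (s * θ ^ 2) * G θ|
      ≤ extDensity s * c * |(1 : ℝ) - 0| := by
    rw [← Real.norm_eq_abs]
    refine intervalIntegral.norm_integral_le_of_norm_le_const fun θ hθ => ?_
    rw [Set.uIoc_of_le zero_le_one] at hθ
    have h2 := extDensity_pos (s * θ ^ 2)
    rw [Real.norm_eq_abs, abs_mul, abs_mul, abs_of_nonneg (pow_nonneg hθ.1.le _), abs_of_pos h2]
    calc _ ≤ 1 * extDensity s * c := by
          gcongr
          · exact pow_le_one₀ hθ.1.le hθ.2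
          · exact extDensity_mul_sq_le s hθ.1.le hθ.2
          · exact hG θ ⟨hθ.1.le, hθ.2⟩
      _ = _ := by ring
  rw [abs_mul, abs_of_pos (by positivity)]
  calc _ ≤ (2 * extDensity s)⁻¹ * (extDensity s * c * |(1 : ℝ) - 0|) := by gcongr
    _ = c / 2 := by
      simp
      field_simp
    _ ≤ c := by linarith

theorem exists_radial_solution (d : ℕ) {l p : ℝ} (hl : 0 ≤ l) (hp : 1 ≤ p) :
    ∃ U : ℝ → ℝ, Continuous U ∧
      ∀ s, U s = l - ∫ t in (0 : ℝ)..s, slope d (truncPow l p) U t := by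
  have hF := continuous_truncPow (l := l) (by linarith : 0 ≤ p)
  refine exists_volterra_solution (M := l ^ p) (K := p * l ^ (p - 1)) (by positivity)
    (by positivity) (fun U hU => continuous_slope d hF hU) (fun U hU t => ?_)
    (fun U V hU hV t c h => ?_) l
  · exact abs_inv_mul_integral_le d fun θ _ => by
      rw [abs_of_nonneg (truncPow_nonneg _ _ _)]
      exact truncPow_le hl (by linarith) _
  · have h1 := abs_inv_mul_integral_le d (s := t)
      (G := fun θ => truncPow l p (U (t * θ ^ 2)) - truncPow l p (V (t * θ ^ 2)))
      (c := p * l ^ (p - 1) * c) fun θ hθ => by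
        refine (abs_truncPow_sub_le hl hp _ _).trans (mul_le_mul_of_nonneg_left (h _ ?_)
          (by positivity))
        rw [abs_mul, abs_of_nonneg (sq_nonneg θ)]
        exact mul_le_of_le_one_right (abs_nonneg t) (pow_le_one₀ hθ.1 hθ.2)
    have hi : ∀ U, Continuous U → IntervalIntegrable
        (fun θ => θ ^ (d - 1) * extDensity (t * θ ^ 2) * truncPow l p (U (t * θ ^ 2)))
        volume 0 1 := fun U hU =>
      ((continuous_slope_integrand d hF hU).comp (Continuous.prodMk_right t)).intervalIntegrable _ _
    simp only [mul_sub] at h1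
    rw [intervalIntegral.integral_sub (hi U hU) (hi V hV), mul_sub] at h1
    exact h1

theorem slope_nonneg (d : ℕ) {F U : ℝ → ℝ} (hF : ∀ u, 0 ≤ F u) (s : ℝ) : 0 ≤ slope d F U s := by
  have hs := extDensity_pos s
  refine mul_nonneg (by positivity) (intervalIntegral.integral_nonneg zero_le_one fun θ hθ => ?_)
  exact mul_nonneg (mul_nonneg (pow_nonneg hθ.1 _) (extDensity_pos _).le) (hF _)

theorem slope_pos (d : ℕ) {F U : ℝ → ℝ} (hF : Continuous F) (hU : Continuous U) {s : ℝ}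
    (h : ∀ θ ∈ Set.Ioo (0 : ℝ) 1, 0 < F (U (s * θ ^ 2))) : 0 < slope d F U s := by
  have hs := extDensity_pos s
  refine mul_pos (by positivity) (intervalIntegral.intervalIntegral_pos_of_pos_on
    (((continuous_slope_integrand d hF hU).comp (Continuous.prodMk_right s)).intervalIntegrable _ _)
    (fun θ hθ => ?_) zero_lt_one)
  exact mul_pos (mul_pos (pow_pos hθ.1 _) (extDensity_pos _)) (h θ hθ)

theorem hasDerivAt_of_volterra {d : ℕ} {F U : ℝ → ℝ} (hF : Continuous F) (hU : Continuous U)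
    {l : ℝ} (hv : ∀ s, U s = l - ∫ t in (0 : ℝ)..s, slope d F U t) (s : ℝ) :
    HasDerivAt U (-slope d F U s) s := by
  have hc := continuous_slope d hF hU
  have h := (intervalIntegral.integral_hasDerivAt_right (hc.intervalIntegrable 0 s)
    (hc.stronglyMeasurableAtFilter _ _) hc.continuousAt).const_sub l
  exact h.congr_of_eventuallyEq (Filter.Eventually.of_forall hv)

/-! ### The Pohozaev argument. -/

/-- The volume density of spheres `r^{d-1} e^{-1/√(1+r²)}`. -/
def area (d : ℕ) (r : ℝ) : ℝ := r ^ (d - 1) * density (r ^ 2)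

/-- The volume of balls, up to the normalization of the unit sphere. -/
def ballVolume (d : ℕ) (r : ℝ) : ℝ := ∫ ρ in (0 : ℝ)..r, area d ρ

theorem continuous_density_sq : Continuous fun r : ℝ => density (r ^ 2) := by
  unfold density
  exact Real.continuous_exp.comp (Continuous.neg (Continuous.inv₀ (by fun_prop) fun s => by
    positivity))

theorem continuous_area (d : ℕ) : Continuous (area d) :=
  (continuous_pow _).mul continuous_density_sq

theorem area_pos (d : ℕ) {r : ℝ} (hr : 0 < r) : 0 < area d r :=
  mul_pos (pow_pos hr _) (density_pos _)

theorem hasDerivAt_integral_of_continuous {G : ℝ → ℝ} (hG : Continuous G) (r : ℝ) :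
    HasDerivAt (fun r => ∫ ρ in (0 : ℝ)..r, G ρ) (G r) r :=
  intervalIntegral.integral_hasDerivAt_right (hG.intervalIntegrable 0 r)
    (hG.stronglyMeasurableAtFilter _ _) hG.continuousAt

theorem hasDerivAt_density_sq (r : ℝ) :
    HasDerivAt (fun r : ℝ => density (r ^ 2)) (r * (√(1 + r ^ 2) ^ 3)⁻¹ * density (r ^ 2)) r := by
  have h : HasDerivAt (fun r : ℝ => density (r ^ 2)) _ r :=
    HasDerivAt.comp (h₂ := density) (h := fun r => r ^ 2) r
      (hasDerivAt_density (by positivity : 0 < 1 + r ^ 2)) (hasDerivAt_pow 2 r)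
  refine h.congr_deriv ?_
  push_cast
  ring

/-- `r A'(r) / A(r)` for the area density `A`. -/
def areaLogSlope (d : ℕ) (r : ℝ) : ℝ := (d - 1) + r ^ 2 * (√(1 + r ^ 2) ^ 3)⁻¹

theorem hasDerivAt_area {d : ℕ} (hd : 3 ≤ d) {r : ℝ} (hr : 0 < r) :
    HasDerivAt (area d) (area d r * areaLogSlope d r / r) r := by
  have h := (hasDerivAt_pow (d - 1) r).fun_mul (hasDerivAt_density_sq r)
  refine h.congr_deriv ?_
  obtain ⟨m, rfl⟩ : ∃ m, d = m + 2 := ⟨d - 2, by omega⟩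
  simp only [area, areaLogSlope, show m + 2 - 1 = m + 1 by omega, Nat.add_sub_cancel]
  push_cast
  field_simp
  ring

theorem areaLogSlope_pos {d : ℕ} (hd : 3 ≤ d) (r : ℝ) : 0 < areaLogSlope d r := by
  have hd' : (3 : ℝ) ≤ d := by exact_mod_cast hd
  have : 0 ≤ r ^ 2 * (√(1 + r ^ 2) ^ 3)⁻¹ := by positivity
  rw [areaLogSlope]
  linarith

/-- The isoperimetric-type inequality `V A' ≥ (1 - 1/d) A²`. -/
theorem area_le_ballVolume {d : ℕ} (hd : 3 ≤ d) {r : ℝ} (hr : 0 ≤ r) :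
    (d - 1) / d * (r * area d r / areaLogSlope d r) ≤ ballVolume d r := by
  have hd' : (3 : ℝ) ≤ d := by exact_mod_cast hd
  have hmd : ∀ r : ℝ, HasDerivAt (areaLogSlope d)
      (2 * r * (√(1 + r ^ 2) ^ 3)⁻¹ - 3 * r ^ 3 * (√(1 + r ^ 2) ^ 5)⁻¹) r := by
    intro r
    have hs : 0 < 1 + r ^ 2 := by positivity
    have h0 : 0 < √(1 + r ^ 2) := Real.sqrt_pos.2 hs
    have h1 : HasDerivAt (fun r : ℝ => √(1 + r ^ 2)) (r / √(1 + r ^ 2)) r := by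
      refine (((hasDerivAt_pow 2 r).const_add 1).sqrt hs.ne').congr_deriv ?_
      field_simp
      simp
    refine (((hasDerivAt_pow 2 r).fun_mul
      ((h1.fun_pow 3).fun_inv (pow_ne_zero 3 h0.ne'))).const_add ((d : ℝ) - 1)).congr_deriv ?_
    push_cast
    field_simp
    ring
  have hmc : Continuous (areaLogSlope d) :=
    continuous_iff_continuousAt.2 fun r => (hmd r).continuousAt
  have hmono : MonotoneOn (fun r => ballVolume d r - (d - 1) / d * (r * area d r / areaLogSlope d r))
      (Set.Ici 0) := by
    refine monotoneOn_of_hasDerivWithinAt_nonneg (convex_Ici 0) ?_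
      -- With $m=rA'/A=(d-1)+e$, the derivative of the difference has the sign of
      -- $m^2-(d-1)m+(d-1)rm'=me+(d-1)rm'$. Since $rm'\ge-e$, this is at least $e^2$.
      (f' := fun r => area d r - (d - 1) / d * (((1 * area d r
        + r * (area d r * areaLogSlope d r / r)) * areaLogSlope d r
        - r * area d r * (2 * r * (√(1 + r ^ 2) ^ 3)⁻¹ - 3 * r ^ 3 * (√(1 + r ^ 2) ^ 5)⁻¹))
        / areaLogSlope d r ^ 2)) (fun r hr => ?_) fun r hr => ?_
    · have hV : Continuous (ballVolume d) := continuous_iff_continuousAt.2 fun r =>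
        (hasDerivAt_integral_of_continuous (continuous_area d) r).continuousAt
      exact (hV.sub (continuous_const.mul ((continuous_id.mul (continuous_area d)).div hmc
        fun r => (areaLogSlope_pos hd r).ne'))).continuousOn
    · rw [interior_Ici] at hr
      exact ((hasDerivAt_integral_of_continuous (continuous_area d) r).fun_sub
        ((((hasDerivAt_id r).fun_mul (hasDerivAt_area hd hr)).fun_div (hmd r)
          (areaLogSlope_pos hd r).ne').const_mul _)).hasDerivWithinAt
    · rw [interior_Ici] at hr
      have hr0 : 0 < r := hr
      have hA := area_pos d hr0
      have hm := areaLogSlope_pos hd r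
      have hs : 0 < 1 + r ^ 2 := by positivity
      have h0 : 0 < √(1 + r ^ 2) := Real.sqrt_pos.2 hs
      have hw := Real.sq_sqrt hs.le
      set e := r ^ 2 * (√(1 + r ^ 2) ^ 3)⁻¹ with he
      have he0 : 0 ≤ e := by positivity
      have hme : areaLogSlope d r = (d - 1) + e := rfl
      have hmr : -e ≤ r * (2 * r * (√(1 + r ^ 2) ^ 3)⁻¹ - 3 * r ^ 3 * (√(1 + r ^ 2) ^ 5)⁻¹) := by
        have h1 : r * (2 * r * (√(1 + r ^ 2) ^ 3)⁻¹ - 3 * r ^ 3 * (√(1 + r ^ 2) ^ 5)⁻¹)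
            = 2 * e - 3 * e * (r ^ 2 / √(1 + r ^ 2) ^ 2) := by
          rw [he]
          field_simp
        have h2 : r ^ 2 / √(1 + r ^ 2) ^ 2 ≤ 1 := by
          rw [hw, div_le_one hs]
          linarith
        rw [h1]
        nlinarith
      have h3 : area d r - (d - 1) / d * (((1 * area d r
        + r * (area d r * areaLogSlope d r / r)) * areaLogSlope d r
        - r * area d r * (2 * r * (√(1 + r ^ 2) ^ 3)⁻¹ - 3 * r ^ 3 * (√(1 + r ^ 2) ^ 5)⁻¹))
        / areaLogSlope d r ^ 2) = area d r / (d * areaLogSlope d r ^ 2) *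
          (d * areaLogSlope d r ^ 2 - (d - 1) * ((1 + areaLogSlope d r) * areaLogSlope d r
            - r * (2 * r * (√(1 + r ^ 2) ^ 3)⁻¹ - 3 * r ^ 3 * (√(1 + r ^ 2) ^ 5)⁻¹))) := by
        have hd0 : (d : ℝ) ≠ 0 := by linarith
        generalize 2 * r * (√(1 + r ^ 2) ^ 3)⁻¹ - 3 * r ^ 3 * (√(1 + r ^ 2) ^ 5)⁻¹ = m'
        field_simp
      rw [h3]
      refine mul_nonneg (by positivity) ?_
      have h4 := mul_le_mul_of_nonneg_left hmr (by linarith : 0 ≤ (d : ℝ) - 1)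
      rw [hme]
      nlinarith [sq_nonneg e]
  have h := hmono (Set.mem_Ici.2 le_rfl) hr hr
  simp only [ballVolume, intervalIntegral.integral_same, zero_mul, zero_div, mul_zero,
    sub_zero] at h
  rw [ballVolume]
  linarith

/-- The integrated equation $-Au'=\int_0^rA\,F(u)$, by the substitution $\rho=r\theta$. -/
theorem two_mul_slope_mul_area {d : ℕ} (F U : ℝ → ℝ) (r : ℝ) :
    2 * r * slope d F U (r ^ 2) * area d r
      = ∫ ρ in (0 : ℝ)..r, area d ρ * F (U (ρ ^ 2)) := by
  have h1 := intervalIntegral.mul_integral_comp_mul_left (a := 0) (b := 1)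
    (f := fun ρ => area d ρ * F (U (ρ ^ 2))) r
  rw [mul_zero, mul_one] at h1
  rw [← h1, slope, extDensity_of_nonneg (sq_nonneg r)]
  have h2 : ∀ θ : ℝ, area d (r * θ) * F (U ((r * θ) ^ 2))
      = r ^ (d - 1) * (θ ^ (d - 1) * extDensity (r ^ 2 * θ ^ 2) * F (U (r ^ 2 * θ ^ 2))) := by
    intro θ
    rw [extDensity_of_nonneg (by positivity), area, mul_pow, mul_pow]
    ring
  simp only [h2, intervalIntegral.integral_const_mul]
  rw [area]
  have := density_pos (r ^ 2)
  field_simp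

/-- The sole place where criticality is used: the inequality rearranges to $p+1\ge 2d/(d-2)$. -/
theorem pohozaev_exponent {d p : ℝ} (hd : 3 ≤ d) (hp : (d + 2) / (d - 2) ≤ p) :
    1 < p ∧ 1 / 2 + 1 / (p + 1) ≤ (d - 1) / d := by
  rw [div_le_iff₀ (by linarith)] at hp
  have hp1 : 1 < p := by
    by_contra h
    nlinarith
  refine ⟨hp1, ?_⟩
  rw [div_add_div _ _ two_ne_zero (by linarith), div_le_div_iff₀ (by linarith) (by linarith)]
  nlinarith

/-- Critical and supercritical radial solutions stay positive, by a Pohozaev-type argument. -/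
theorem radial_solution_pos {d : ℕ} (hd : 3 ≤ d) {p l : ℝ}
    (hp : ((d : ℝ) + 2) / ((d : ℝ) - 2) ≤ p) (hl : 0 < l) {U : ℝ → ℝ} (hU : Continuous U)
    (hv : ∀ s, U s = l - ∫ t in (0 : ℝ)..s, slope d (truncPow l p) U t) {s : ℝ} (hs : 0 ≤ s) :
    0 < U s := by
  have hd' : (3 : ℝ) ≤ d := by exact_mod_cast hd
  obtain ⟨hp1, hpe⟩ := pohozaev_exponent hd' hp
  have hF := continuous_truncPow (l := l) (by linarith : 0 ≤ p)
  have hder := hasDerivAt_of_volterra hF hU hv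
  have hU0 : U 0 = l := by rw [hv]; simp
  have hle : ∀ s, 0 ≤ s → U s ≤ l := by
    intro s hs
    have := intervalIntegral.integral_nonneg (μ := volume) hs fun t _ =>
      slope_nonneg d (U := U) (truncPow_nonneg l p) t
    rw [hv]
    linarith
  set u : ℝ → ℝ := fun r => U (r ^ 2) with hu
  have huc : Continuous u := hU.comp (continuous_pow 2)
  by_contra hneg
  -- If positivity fails, let $R$ be the first zero: $Z$ is closed and $u(0)=\ell>0$.
  set Z : Set ℝ := {r | 0 ≤ r ∧ u r ≤ 0} with hZ
  have hZc : IsClosed Z := (isClosed_le continuous_const continuous_id).inter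
    (isClosed_le huc continuous_const)
  have hZne : Z.Nonempty := ⟨√s, Real.sqrt_nonneg s, by
    simp only [hu, Real.sq_sqrt hs]
    exact not_lt.1 hneg⟩
  have hZb : BddBelow Z := ⟨0, fun r hr => hr.1⟩
  obtain ⟨R, hRdef⟩ : ∃ R, R = sInf Z := ⟨_, rfl⟩
  have hRZ : R ∈ Z := hRdef ▸ hZc.csInf_mem hZne hZb
  have hlt : ∀ r, 0 ≤ r → r < R → 0 < u r := by
    intro r hr hrR
    by_contra h
    exact absurd (csInf_le hZb ⟨hr, not_lt.1 h⟩) (not_le.2 (hRdef ▸ hrR))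
  have hR0 : 0 < R := by
    rcases hRZ.1.eq_or_lt with h | h
    · have h1 := hRZ.2
      simp only [hu, ← h] at h1
      norm_num [hU0] at h1
      linarith
    · exact h
  set q : ℝ → ℝ := fun r => 2 * r * slope d (truncPow l p) U (r ^ 2) with hq
  have hqc : Continuous q := by
    have := continuous_slope d hF hU
    simp only [hq]
    fun_prop
  set N : ℝ → ℝ := fun r => ∫ ρ in (0 : ℝ)..r, area d ρ * truncPow l p (U (ρ ^ 2)) with hN
  have hqN : ∀ r, q r * area d r = N r := fun r => two_mul_slope_mul_area _ _ r
  have hNd : ∀ r, HasDerivAt N (area d r * truncPow l p (u r)) r := fun r =>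
    hasDerivAt_integral_of_continuous ((continuous_area d).mul (hF.comp huc)) r
  have hud : ∀ r, HasDerivAt u (-q r) r := by
    intro r
    refine ((hder (r ^ 2)).comp r (hasDerivAt_pow 2 r)).congr_deriv ?_
    simp only [hq]
    push_cast
    ring
  have hqd : ∀ r, 0 < r → HasDerivAt q (truncPow l p (u r) - q r * areaLogSlope d r / r) r := by
    intro r hr
    have hA := area_pos d hr
    have h1 := (hNd r).fun_div (hasDerivAt_area hd hr) hA.ne'
    have h2 : HasDerivAt q ((area d r * truncPow l p (u r) * area d r
        - N r * (area d r * areaLogSlope d r / r)) / area d r ^ 2) r := by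
      refine h1.congr_of_eventuallyEq ?_
      filter_upwards [lt_mem_nhds hr] with t ht
      rw [← hqN, mul_div_cancel_right₀ _ (area_pos d ht).ne']
    refine h2.congr_deriv ?_
    rw [← hqN]
    field_simp
  set P : ℝ → ℝ := fun r => ballVolume d r * (q r ^ 2 / 2 + u r ^ (p + 1) / (p + 1))
    - N r * u r / (p + 1) with hP
  have hPanti : AntitoneOn P (Set.Icc 0 R) := by
    refine antitoneOn_of_hasDerivWithinAt_nonpos (convex_Icc 0 R) ?_
      (f' := fun r => area d r * (q r ^ 2 / 2 + u r ^ (p + 1) / (p + 1))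
        + ballVolume d r * (q r * (truncPow l p (u r) - q r * areaLogSlope d r / r)
          + u r ^ p * (-q r))
        - (area d r * truncPow l p (u r) * u r + N r * (-q r)) / (p + 1))
      (fun r hr => ?_) fun r hr => ?_
    · have h1 : Continuous (ballVolume d) := continuous_iff_continuousAt.2 fun r =>
        (hasDerivAt_integral_of_continuous (continuous_area d) r).continuousAt
      have h2 : Continuous N := continuous_iff_continuousAt.2 fun r => (hNd r).continuousAt
      have h3 : Continuous fun r => u r ^ (p + 1) := huc.rpow_const fun _ => Or.inr (by linarith)
      have h4 : Continuous P := by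
        simp only [hP]
        fun_prop
      exact h4.continuousOn
    · rw [interior_Icc] at hr
      have hu0 := hlt r hr.1.le hr.2
      have h1 : HasDerivAt (fun r => q r ^ 2 / 2)
          (q r * (truncPow l p (u r) - q r * areaLogSlope d r / r)) r := by
        refine (((hqd r hr.1).fun_pow 2).div_const 2).congr_deriv ?_
        push_cast
        ring
      have h2 : HasDerivAt (fun r => u r ^ (p + 1) / (p + 1)) (u r ^ p * (-q r)) r := by
        refine (((hud r).rpow_const (p := p + 1) (Or.inl hu0.ne')).div_const (p + 1)).congr_deriv ?_
        rw [add_sub_cancel_right]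
        have : p + 1 ≠ 0 := by linarith
        field_simp
      exact (((hasDerivAt_integral_of_continuous (continuous_area d) r).fun_mul
        (h1.fun_add h2)).fun_sub (((hNd r).fun_mul (hud r)).div_const (p + 1))).hasDerivWithinAt
    · rw [interior_Icc] at hr
      have hr0 : 0 < r := hr.1
      have hu0 := hlt r hr.1.le hr.2
      have hA := area_pos d hr0
      have hm := areaLogSlope_pos hd r
      have hV := area_le_ballVolume hd hr0.le
      have hpp : u r ^ (p + 1) = u r ^ p * u r := by rw [Real.rpow_add hu0, Real.rpow_one]
      have hT : truncPow l p (u r) = u r ^ p := truncPow_of_mem hu0.le (hle _ (sq_nonneg r))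
      have hVm : (d - 1) / d * area d r ≤ ballVolume d r * areaLogSlope d r / r := by
        have h1 := mul_le_mul_of_nonneg_right hV (by positivity : 0 ≤ areaLogSlope d r / r)
        have h2 : (d - 1) / d * (r * area d r / areaLogSlope d r) * (areaLogSlope d r / r)
            = (d - 1) / d * area d r := by
          field_simp
        rw [h2] at h1
        rwa [mul_div_assoc]
      rw [hT, ← hqN, hpp]
      -- All terms containing $u$ cancel in $P'$; a multiple of $q^2$ remains.
      have h5 : area d r * (q r ^ 2 / 2 + u r ^ p * u r / (p + 1))
        + ballVolume d r * (q r * (u r ^ p - q r * areaLogSlope d r / r) + u r ^ p * (-q r))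
        - (area d r * u r ^ p * u r + q r * area d r * (-q r)) / (p + 1)
        = q r ^ 2 * (area d r * (1 / 2 + 1 / (p + 1))
          - ballVolume d r * areaLogSlope d r / r) := by
        ring
      rw [h5]
      refine mul_nonpos_of_nonneg_of_nonpos (sq_nonneg _) ?_
      have := mul_le_mul_of_nonneg_left hpe hA.le
      linarith
  have hP0 : P 0 = 0 := by simp [hP, hN, ballVolume]
  have hcl : 0 ≤ u R := by
    refine ge_of_tendsto (huc.continuousWithinAt (s := Set.Iio R)) ?_
    filter_upwards [self_mem_nhdsWithin, mem_nhdsWithin_of_mem_nhds (lt_mem_nhds hR0)]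
      with r hr hr0
    exact (hlt r (le_of_lt hr0) hr).le
  have huR : u R = 0 := le_antisymm hRZ.2 hcl
  -- The zero is transversal, because the flux through radius $R$ integrates a source that is
  -- positive inside.
  have hqR : 0 < q R := by
    refine mul_pos (by positivity) (slope_pos d hF hU fun θ hθ => ?_)
    have hθR : 0 < u (R * θ) := hlt _ (mul_nonneg hR0.le hθ.1.le)
      (mul_lt_of_lt_one_right hR0 hθ.2)
    have h1 : U (R ^ 2 * θ ^ 2) = u (R * θ) := by simp only [hu, mul_pow]
    rw [h1, truncPow_of_mem hθR.le (hle _ (sq_nonneg _))]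
    exact Real.rpow_pos_of_pos hθR p
  have hVR : 0 < ballVolume d R :=
    intervalIntegral.intervalIntegral_pos_of_pos_on ((continuous_area d).intervalIntegrable _ _)
      (fun r hr => area_pos d hr.1) hR0
  have hPR : 0 < P R := by
    simp only [hP, huR, Real.zero_rpow (by linarith : p + 1 ≠ 0)]
    have : 0 < ballVolume d R * (q R ^ 2 / 2) := by positivity
    simpa using this
  have := hPanti ⟨le_rfl, hR0.le⟩ ⟨hR0.le, le_rfl⟩ hR0.le
  linarith

/-! ### Decay of the solution. -/

/-- As $U$ decreases, $U(s\theta^2)\ge U(s)$. Bounding the density below by its value at $0$ inside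
the integral and above by $1$ outside leaves $\int_0^1\theta^{d-1}=1/d$. -/
theorem rpow_le_slope {d : ℕ} (hd : 3 ≤ d) {p l : ℝ} (hp : 0 ≤ p) {U : ℝ → ℝ} (hU : Continuous U)
    (hpos : ∀ s, 0 ≤ s → 0 < U s) (hle : ∀ s, 0 ≤ s → U s ≤ l) (hanti : Antitone U) {s : ℝ}
    (hs : 0 ≤ s) : density 0 / (2 * d) * U s ^ p ≤ slope d (truncPow l p) U s := by
  have hd' : (3 : ℝ) ≤ d := by exact_mod_cast hd
  have hF := continuous_truncPow (l := l) hp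
  have h1 : ∫ θ in (0 : ℝ)..1, θ ^ (d - 1) * (density 0 * U s ^ p) = density 0 / d * U s ^ p := by
    rw [intervalIntegral.integral_mul_const, integral_pow]
    have : ((d - 1 : ℕ) : ℝ) + 1 = d := by
      rw [Nat.cast_sub (by omega)]
      simp
    rw [this, one_pow, zero_pow (by omega)]
    ring
  have h2 : density 0 / d * U s ^ p
      ≤ ∫ θ in (0 : ℝ)..1, θ ^ (d - 1) * extDensity (s * θ ^ 2) * truncPow l p (U (s * θ ^ 2)) := by
    rw [← h1]
    refine intervalIntegral.integral_mono_on zero_le_one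
      ((by fun_prop : Continuous fun θ : ℝ => θ ^ (d - 1) * (density 0 * U s ^ p)).intervalIntegrable
        _ _)
      (((continuous_slope_integrand d hF hU).comp
        (Continuous.prodMk_right s)).intervalIntegrable _ _) fun θ hθ => ?_
    have h3 : 0 ≤ s * θ ^ 2 := by positivity
    have h4 : s * θ ^ 2 ≤ s := mul_le_of_le_one_right hs (pow_le_one₀ hθ.1 hθ.2)
    rw [extDensity_of_nonneg h3, truncPow_of_mem (hpos _ h3).le (hle _ h3), mul_assoc]
    have h5 := hpos s hs
    have h6 := (density_pos 0).le
    refine mul_le_mul_of_nonneg_left (mul_le_mul (density_le_density le_rfl h3)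
      (Real.rpow_le_rpow h5.le (hanti h4) hp) (by positivity) (density_pos _).le)
      (pow_nonneg hθ.1 _)
  have h7 : (2 * 1)⁻¹ ≤ (2 * extDensity s)⁻¹ :=
    inv_anti₀ (mul_pos two_pos (extDensity_pos s))
      (mul_le_mul_of_nonneg_left (density_le_one _) two_pos.le)
  have h8 : 0 ≤ density 0 / d * U s ^ p := by
    have := (density_pos 0).le
    have := hpos s hs
    positivity
  calc _ = (2 * 1)⁻¹ * (density 0 / d * U s ^ p) := by
        field_simp
    _ ≤ _ := mul_le_mul h7 h2 h8 (by have := extDensity_pos s; positivity)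

/-- Decay estimate from the differential inequality `U' ≤ -c U^p`. -/
theorem le_rpow_of_deriv_le {U U' : ℝ → ℝ} {c p : ℝ} (hp : 1 < p)
    (hpos : ∀ s, 0 ≤ s → 0 < U s) (hder : ∀ s, HasDerivAt U (-U' s) s)
    (hle : ∀ s, 0 ≤ s → c * U s ^ p ≤ U' s) (hc : 0 < c) {s : ℝ} (hs : 0 ≤ s) :
    U s ≤ (1 / ((p - 1) * c * s + U 0 ^ (1 - p))) ^ (1 / (p - 1)) := by
  have hd : ∀ t, 0 ≤ t → HasDerivAt (fun t => U t ^ (1 - p) - (p - 1) * c * t)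
      ((p - 1) * (U' t * U t ^ (-p)) - (p - 1) * c) t := by
    intro t ht
    have h1 := (hder t).rpow_const (p := 1 - p) (Or.inl (hpos t ht).ne')
    refine (h1.fun_sub ((hasDerivAt_id t).const_mul ((p - 1) * c))).congr_deriv ?_
    rw [show 1 - p - 1 = -p by ring]
    ring
  -- The inequality says that $U^{1-p}$ grows at rate at least $(p-1)c$.
  have hmono : MonotoneOn (fun t => U t ^ (1 - p) - (p - 1) * c * t) (Set.Ici 0) := by
    refine monotoneOn_of_hasDerivWithinAt_nonneg (convex_Ici 0)
      (fun t ht => (hd t ht).continuousAt.continuousWithinAt)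
      (fun t ht => (hd t (interior_subset ht)).hasDerivWithinAt) fun t ht => ?_
    have ht0 : 0 ≤ t := interior_subset ht
    have hUt := hpos t ht0
    have h1 := mul_le_mul_of_nonneg_right (hle t ht0) (Real.rpow_nonneg hUt.le (-p))
    rw [mul_assoc, ← Real.rpow_add hUt, add_neg_cancel, Real.rpow_zero, mul_one] at h1
    have h2 := mul_le_mul_of_nonneg_left h1 (by linarith : 0 ≤ p - 1)
    linarith
  have h := hmono (Set.mem_Ici.2 le_rfl) hs hs
  simp only [mul_zero, sub_zero] at h
  have hUs := hpos s hs
  have hU0 := Real.rpow_pos_of_pos (hpos 0 le_rfl) (1 - p)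
  have hp0 : 0 < p - 1 := by linarith
  have hX : 0 < (p - 1) * c * s + U 0 ^ (1 - p) := by positivity
  have h2 : U s ^ (p - 1) ≤ 1 / ((p - 1) * c * s + U 0 ^ (1 - p)) := by
    rw [le_div_iff₀ hX]
    calc _ ≤ U s ^ (p - 1) * U s ^ (1 - p) :=
          mul_le_mul_of_nonneg_left (by linarith) (Real.rpow_nonneg hUs.le _)
      _ = 1 := by
        rw [← Real.rpow_add hUs]
        simp
  calc U s = (U s ^ (p - 1)) ^ (1 / (p - 1)) := by
        rw [← Real.rpow_mul hUs.le, mul_one_div_cancel hp0.ne', Real.rpow_one]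
    _ ≤ _ := Real.rpow_le_rpow (Real.rpow_nonneg hUs.le _) h2 (by positivity)

/-! ### Integrals over dilations, smoothness and the equation. -/

section DilationIntegral

variable {E : Type*} [NormedAddCommGroup E] [NormedSpace ℝ E] [ProperSpace E]

/-- Differentiation under the integral sign for integrals over dilations. -/
theorem hasFDerivAt_integral_dilation {F : Type*} [NormedAddCommGroup F] [NormedSpace ℝ F]
    [CompleteSpace F] {h : E → F} (hh : ContDiff ℝ 1 h) (m : ℕ) (x : E) :
    HasFDerivAt (fun x => ∫ θ in (0 : ℝ)..1, θ ^ m • h (θ • x))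
      (∫ θ in (0 : ℝ)..1, θ ^ (m + 1) • fderiv ℝ h (θ • x)) x := by
  have hc := hh.continuous
  have hc' : Continuous (fderiv ℝ h) := hh.continuous_fderiv one_ne_zero
  have hJ : Continuous fun q : E × ℝ => q.2 ^ (m + 1) • fderiv ℝ h (q.2 • q.1) := by fun_prop
  obtain ⟨C, hC⟩ := ((isCompact_closedBall x 1).prod
    (isCompact_Icc (a := (0 : ℝ)) (b := 1))).exists_bound_of_continuousOn hJ.continuousOn
  refine intervalIntegral.hasFDerivAt_integral_of_dominated_of_fderiv_le
    (F := fun (y : E) (θ : ℝ) => θ ^ m • h (θ • y))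
    (F' := fun (y : E) (θ : ℝ) => θ ^ (m + 1) • fderiv ℝ h (θ • y)) (bound := fun _ => C)
    (Metric.closedBall_mem_nhds x one_pos) (Filter.Eventually.of_forall fun y => ?_) ?_ ?_
    (Filter.Eventually.of_forall fun θ hθ y hy => ?_) (by simp)
    (Filter.Eventually.of_forall fun θ hθ y hy => ?_)
  · exact (by fun_prop : Continuous fun θ : ℝ => θ ^ m • h (θ • y)).aestronglyMeasurable
  · exact (by fun_prop : Continuous fun θ : ℝ => θ ^ m • h (θ • x)).intervalIntegrable _ _
  · exact (by fun_prop :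
      Continuous fun θ : ℝ => θ ^ (m + 1) • fderiv ℝ h (θ • x)).aestronglyMeasurable
  · rw [Set.uIoc_of_le zero_le_one] at hθ
    exact hC (y, θ) ⟨hy, hθ.1.le, hθ.2⟩
  · have h1 : HasFDerivAt (fun y : E => θ • y) (θ • ContinuousLinearMap.id ℝ E) y :=
      (hasFDerivAt_id y).const_smul θ
    have h2 := (((hh.differentiable one_ne_zero) (θ • y)).hasFDerivAt.comp y h1).const_smul (θ ^ m)
    refine h2.congr_fderiv ?_
    ext v
    simp [pow_succ, mul_smul]

/-- Differentiation gives an integral of the same kind with $m+1$ and `fderiv ℝ h`. The target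
varies in the induction, and shares the universe of `E` so that spaces of linear maps remain
admissible. -/
theorem contDiff_integral_dilation.{u} {E : Type u} [NormedAddCommGroup E] [NormedSpace ℝ E]
    [ProperSpace E] (n : ℕ) : ∀ (m : ℕ) {F : Type u} [NormedAddCommGroup F]
    [NormedSpace ℝ F] [CompleteSpace F] {h : E → F}, ContDiff ℝ n h →
    ContDiff ℝ n fun x => ∫ θ in (0 : ℝ)..1, θ ^ m • h (θ • x) := by
  induction n with
  | zero =>
    intro m F _ _ _ h hh
    have hc := hh.continuous
    refine contDiff_zero.2
      (intervalIntegral.continuous_parametric_intervalIntegral_of_continuous' ?_ 0 1)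
    simp only [Function.uncurry_def]
    fun_prop
  | succ n ih =>
    intro m F _ _ _ h hh
    push_cast at hh ⊢
    refine contDiff_succ_iff_hasFDerivAt.2 ⟨_, ih (m + 1) ?_, fun x =>
      hasFDerivAt_integral_dilation (hh.of_le (by simp)) m x⟩
    exact (contDiff_succ_iff_fderiv.1 hh).2.2

/-- Euler's identity for integrals over dilations. -/
theorem integral_dilation_euler {h : E → ℝ} (hh : ContDiff ℝ 1 h) (m : ℕ) (x : E) :
    (m + 1) * (∫ θ in (0 : ℝ)..1, θ ^ m • h (θ • x))
      + fderiv ℝ (fun x => ∫ θ in (0 : ℝ)..1, θ ^ m • h (θ • x)) x x = h x := by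
  have hc := hh.continuous
  have hc' : Continuous (fderiv ℝ h) := hh.continuous_fderiv one_ne_zero
  have hi : IntervalIntegrable (fun θ : ℝ => θ ^ (m + 1) • fderiv ℝ h (θ • x)) volume 0 1 :=
    Continuous.intervalIntegrable (by fun_prop) _ _
  rw [(hasFDerivAt_integral_dilation hh m x).fderiv,
    ContinuousLinearMap.intervalIntegral_apply hi, ← intervalIntegral.integral_const_mul,
    ← intervalIntegral.integral_add (Continuous.intervalIntegrable (by fun_prop) _ _)
      (Continuous.intervalIntegrable (by fun_prop) _ _)]
  have hd : ∀ θ ∈ Set.uIcc (0 : ℝ) 1, HasDerivAt (fun θ : ℝ => θ ^ (m + 1) * h (θ • x))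
      ((m + 1) * θ ^ m • h (θ • x) + (θ ^ (m + 1) • fderiv ℝ h (θ • x)) x) θ := by
    intro θ _
    have h1 : HasDerivAt (fun θ : ℝ => θ • x) x θ := by
      simpa using (hasDerivAt_id θ).smul_const x
    have h2 : HasDerivAt (fun θ : ℝ => h (θ • x)) (fderiv ℝ h (θ • x) x) θ :=
      ((hh.differentiable one_ne_zero) (θ • x)).hasFDerivAt.comp_hasDerivAt θ h1
    refine ((hasDerivAt_pow (m + 1) θ).fun_mul h2).congr_deriv ?_
    simp
    ring
  rw [intervalIntegral.integral_eq_sub_of_hasDerivAt hd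
    (Continuous.intervalIntegrable (by fun_prop) _ _)]
  simp

end DilationIntegral

theorem sum_mul_pd {d : ℕ} (h : Space d → ℝ) (x : Space d) :
    ∑ i, x i * pd i h x = fderiv ℝ h x x := by
  have hx : x = ∑ i, x i • coordVec i := by
    ext j
    simp [coordVec, Pi.single_apply]
  conv_rhs => rw [hx]
  rw [map_sum, ← hx]
  simp [pd]

/-- The integral `∫₀¹ θ^{d-1} b(θx) U(|θx|²)^p dθ`, the flux of a radial solution. -/
def flux (d : ℕ) (p : ℝ) (U : ℝ → ℝ) (x : Space d) : ℝ :=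
  ∫ θ in (0 : ℝ)..1, θ ^ (d - 1) • (density (‖θ • x‖ ^ 2) * U (‖θ • x‖ ^ 2) ^ p)

/-- The radial coefficient `k` in `∂_j u = x_j k`. -/
def radialCoeff (d : ℕ) (p : ℝ) (U : ℝ → ℝ) (x : Space d) : ℝ :=
  -(flux d p U x) * (density (‖x‖ ^ 2))⁻¹

/-- Since $0<U\le\ell$ on $s\ge0$, the truncation disappears and the slope becomes a dilation
integral of a function on space. -/
theorem two_mul_slope_eq {d : ℕ} {p l : ℝ} {U : ℝ → ℝ} (hpos : ∀ s, 0 ≤ s → 0 < U s)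
    (hle : ∀ s, 0 ≤ s → U s ≤ l) (x : Space d) :
    2 * -slope d (truncPow l p) U (‖x‖ ^ 2) = radialCoeff d p U x := by
  have h1 : ∀ θ : ℝ, θ ^ (d - 1) * extDensity (‖x‖ ^ 2 * θ ^ 2) * truncPow l p (U (‖x‖ ^ 2 * θ ^ 2))
      = θ ^ (d - 1) • (density (‖θ • x‖ ^ 2) * U (‖θ • x‖ ^ 2) ^ p) := by
    intro θ
    have h2 : ‖θ • x‖ ^ 2 = ‖x‖ ^ 2 * θ ^ 2 := by
      rw [norm_smul, mul_pow, Real.norm_eq_abs, sq_abs, mul_comm]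
    have h3 : 0 ≤ ‖x‖ ^ 2 * θ ^ 2 := by positivity
    rw [h2, extDensity_of_nonneg h3, truncPow_of_mem (hpos _ h3).le (hle _ h3), smul_eq_mul,
      mul_assoc]
  rw [slope, radialCoeff, flux, extDensity_of_nonneg (sq_nonneg _)]
  simp only [h1]
  rw [mul_inv]
  ring

section RadialSolution

variable {d : ℕ} {p l : ℝ} {U : ℝ → ℝ}

theorem hasFDerivAt_radial_solution (hpos : ∀ s, 0 ≤ s → 0 < U s) (hle : ∀ s, 0 ≤ s → U s ≤ l)
    (hder : ∀ s, HasDerivAt U (-slope d (truncPow l p) U s) s) (x : Space d) :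
    HasFDerivAt (fun y : Space d => U (‖y‖ ^ 2)) (radialCoeff d p U x • innerSL ℝ x) x := by
  refine ((hder (‖x‖ ^ 2)).comp_hasFDerivAt x (hasFDerivAt_norm_sq x)).congr_fderiv ?_
  rw [← two_mul_slope_eq hpos hle, two_smul, ← two_smul ℝ, smul_smul]
  ring_nf

theorem pd_radial_solution (hpos : ∀ s, 0 ≤ s → 0 < U s) (hle : ∀ s, 0 ≤ s → U s ≤ l)
    (hder : ∀ s, HasDerivAt U (-slope d (truncPow l p) U s) s) (j : Fin d) (x : Space d) :
    pd j (fun y : Space d => U (‖y‖ ^ 2)) x = x j * radialCoeff d p U x := by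
  rw [pd, (hasFDerivAt_radial_solution hpos hle hder x).fderiv]
  simp [coordVec, EuclideanSpace.inner_single_right]
  ring

theorem contDiff_source (hpos : ∀ s, 0 ≤ s → 0 < U s) {n : ℕ}
    (hu : ContDiff ℝ n fun y : Space d => U (‖y‖ ^ 2)) :
    ContDiff ℝ n fun y : Space d => density (‖y‖ ^ 2) * U (‖y‖ ^ 2) ^ p :=
  contDiff_density_norm_sq.mul (hu.rpow_const_of_ne fun _ => (hpos _ (sq_nonneg _)).ne')

theorem contDiff_radialCoeff (hpos : ∀ s, 0 ≤ s → 0 < U s) {n : ℕ}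
    (hu : ContDiff ℝ n fun y : Space d => U (‖y‖ ^ 2)) : ContDiff ℝ n (radialCoeff d p U) :=
  (contDiff_integral_dilation n (d - 1) (contDiff_source hpos hu)).neg.mul
    (contDiff_density_norm_sq.inv fun _ => (density_pos _).ne')

/-- Bootstrap: if $u$ is $C^n$, so is its radial coefficient, hence $\nabla u$, and $u$ is
$C^{n+1}$. Positivity keeps $u^p$ as smooth as $u$. -/
theorem contDiff_radial_solution (hpos : ∀ s, 0 ≤ s → 0 < U s) (hle : ∀ s, 0 ≤ s → U s ≤ l)
    (hder : ∀ s, HasDerivAt U (-slope d (truncPow l p) U s) s) :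
    ContDiff ℝ ∞ fun y : Space d => U (‖y‖ ^ 2) := by
  refine contDiff_infty.2 fun n => ?_
  induction n with
  | zero =>
    exact contDiff_zero.2 (continuous_iff_continuousAt.2 fun x =>
      (hasFDerivAt_radial_solution hpos hle hder x).continuousAt)
  | succ n ih =>
    push_cast
    exact contDiff_succ_iff_hasFDerivAt.2 ⟨_, (contDiff_radialCoeff hpos ih).smul
      (innerSL ℝ).contDiff, hasFDerivAt_radial_solution hpos hle hder⟩

/-- Euler's identity for the flux, divided by the density: the radial equation in a form valid at
the pole. -/
theorem fderiv_radialCoeff_self (hd : 3 ≤ d) (hpos : ∀ s, 0 ≤ s → 0 < U s)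
    (hu : ContDiff ℝ 1 fun y : Space d => U (‖y‖ ^ 2)) (x : Space d) :
    fderiv ℝ (radialCoeff d p U) x x
      = -U (‖x‖ ^ 2) ^ p - (d + ‖x‖ ^ 2 * (√(1 + ‖x‖ ^ 2) ^ 3)⁻¹) * radialCoeff d p U x := by
  have hb := density_pos (‖x‖ ^ 2)
  have hK := integral_dilation_euler (contDiff_source (p := p) (n := 1) hpos (by simpa using hu))
    (d - 1) x
  have hk1 : DifferentiableAt ℝ (radialCoeff d p U) x :=
    (contDiff_radialCoeff (n := 1) hpos (by simpa using hu)).differentiable (by simp) x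
  have hb1 : DifferentiableAt ℝ (fun x : Space d => density (‖x‖ ^ 2)) x :=
    (contDiff_density_norm_sq (n := 1)).differentiable (by simp) x
  have hflux : flux d p U = fun y => -(radialCoeff d p U y * density (‖y‖ ^ 2)) := by
    funext y
    rw [radialCoeff, inv_mul_cancel_right₀ (density_pos _).ne', neg_neg]
  have hbx : fderiv ℝ (fun x : Space d => density (‖x‖ ^ 2)) x x
      = ‖x‖ ^ 2 * (√(1 + ‖x‖ ^ 2) ^ 3)⁻¹ * density (‖x‖ ^ 2) := by
    have h1 : HasFDerivAt (fun x : Space d => density (‖x‖ ^ 2)) _ x :=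
      HasDerivAt.comp_hasFDerivAt (h₂ := density) (f := fun x : Space d => ‖x‖ ^ 2) x
        (hasDerivAt_density (one_add_norm_sq_pos x)) (hasFDerivAt_norm_sq x)
    rw [h1.fderiv]
    simp
    ring
  have hdd : ((d - 1 : ℕ) : ℝ) + 1 = d := by
    rw [Nat.cast_sub (by omega)]
    simp
  change (((d - 1 : ℕ) : ℝ) + 1) * flux d p U x + fderiv ℝ (flux d p U) x x = _ at hK
  rw [hdd, hflux, fderiv_fun_neg, fderiv_fun_mul hk1 hb1] at hK
  simp only [neg_apply, add_apply, smul_apply, smul_eq_mul, hbx] at hK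
  refine mul_left_cancel₀ hb.ne' ?_
  linarith

/-- The term $(d-1)/(1+r^2)$ of the Laplacian and the logarithmic part of $f$ add up to $d-1$, and
the remaining multiples of the radial coefficient cancel. -/
theorem weightedLaplacian_radial_solution (hd : 3 ≤ d) (hpos : ∀ s, 0 ≤ s → 0 < U s)
    (hle : ∀ s, 0 ≤ s → U s ≤ l) (hder : ∀ s, HasDerivAt U (-slope d (truncPow l p) U s) s)
    (x : Space d) :
    weightedLaplacian (cigarMetric d) (potential d) (fun y => U (‖y‖ ^ 2)) x
      = -U (‖x‖ ^ 2) ^ p := by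
  have hu : ContDiff ℝ 1 fun y : Space d => U (‖y‖ ^ 2) :=
    (contDiff_radial_solution hpos hle hder).of_le (by simp)
  have hk1 : DifferentiableAt ℝ (radialCoeff d p U) x :=
    (contDiff_radialCoeff (n := 1) hpos (by simpa using hu)).differentiable (by simp) x
  have hpd := pd_radial_solution hpos hle hder
  rw [weightedLaplacian, laplacian_cigarMetric hpd hk1, sum_mul_pd,
    fderiv_radialCoeff_self hd hpos hu, grad_cigarMetric fun j => pd_potential j x,
    grad_cigarMetric fun j => hpd j x, ip_smul_smul_cigarMetric, potentialSlope]
  have hs := one_add_norm_sq_pos x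
  have h2 : (1 + ‖x‖ ^ 2)⁻¹ * ‖x‖ ^ 2 = 1 - (1 + ‖x‖ ^ 2)⁻¹ := by
    field_simp
    ring
  linear_combination (d - 1) * radialCoeff d p U x * h2

end RadialSolution

/-! ### Assembly of the example. -/

theorem ricInfty_potential_nonneg {d : ℕ} (hd : 3 ≤ d) (x v : Space d) :
    0 ≤ ricInfty (cigarMetric d) (potential d) x v v := by
  rcases eq_or_ne v 0 with rfl | hv
  · simp [ricInfty]
  · exact (ricInfty_potential hd x v hv).le

/-- Both $f$ and $u$ decrease in $r$, hence $\nabla f\cdot\nabla u>0$ off the pole. -/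
theorem potentialSlope_neg {d : ℕ} (hd : 3 ≤ d) {s : ℝ} (hs : 0 < 1 + s) :
    potentialSlope d s < 0 := by
  have hd' : (3 : ℝ) ≤ d := by exact_mod_cast hd
  have h1 : 0 < ((d : ℝ) - 1) * (1 + s)⁻¹ := mul_pos (by linarith) (inv_pos.2 hs)
  have h2 : 0 < (√(1 + s) ^ 3)⁻¹ := by positivity
  rw [potentialSlope]
  linarith

/-- The profile of the positive radial solution in the variable `s = r²`. -/
theorem exists_radial_profile {d : ℕ} (hd : 3 ≤ d) {p l : ℝ}
    (hp : ((d : ℝ) + 2) / ((d : ℝ) - 2) ≤ p) (hl : 0 < l) :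
    ∃ U : ℝ → ℝ, Continuous U ∧ U 0 = l ∧ (∀ s, 0 ≤ s → 0 < U s) ∧ (∀ s, 0 ≤ s → U s ≤ l) ∧
      Antitone U ∧ ∀ s, HasDerivAt U (-slope d (truncPow l p) U s) s := by
  have hd' : (3 : ℝ) ≤ d := by exact_mod_cast hd
  have hp1 := (pohozaev_exponent hd' hp).1
  obtain ⟨U, hU, hv⟩ := exists_radial_solution d hl.le hp1.le
  have hder := hasDerivAt_of_volterra (continuous_truncPow (by linarith)) hU hv
  have hU0 : U 0 = l := by rw [hv]; simp
  have hanti : Antitone U := antitone_of_hasDerivAt_nonpos hder fun s =>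
    neg_nonpos.2 (slope_nonneg d (truncPow_nonneg l p) s)
  exact ⟨U, hU, hU0, fun s hs => radial_solution_pos hd hp hl hU hv hs,
    fun s hs => hU0 ▸ hanti hs, hanti, hder⟩

end WeightedModel

end

theorem theorem2p2 (d : ℕ) (hd : 3 ≤ d) :
    ∃ (g : WeightedModel.SmoothMetric d) (f : WeightedModel.Space d → ℝ),
      -- a smooth, rotationally symmetric, complete weighted manifold with pole `0`
      WeightedModel.IsModelMetric g ∧
      ContDiff ℝ ∞ f ∧
      WeightedModel.IsRadial g 0 f ∧
      WeightedModel.IsCompleteMetric g ∧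
      -- `Ric_{∞,d} ≥ 0`, and `> 0` away from the pole
      (∀ x v, 0 ≤ WeightedModel.ricInfty g f x v v) ∧
      (∀ x, x ≠ 0 → ∀ v, v ≠ 0 → 0 < WeightedModel.ricInfty g f x v v) ∧
      -- Euclidean weighted volume growth
      (∃ C : ℝ, 0 < C ∧ ∀ R : ℝ, 0 < R →
        WeightedModel.weightedMeasure g f (WeightedModel.geodBall g 0 R)
          ≤ ENNReal.ofReal (C * R ^ d)) ∧
      -- the sharp Laplacian comparison fails, a rough one holds
      ¬ WeightedModel.LaplacianComparison g f 0 ((d : ℝ) - 1) ∧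
      (∃ C : ℝ, 0 < C ∧ WeightedModel.LaplacianComparison g f 0 C) ∧
      -- critical and supercritical solutions
      ∀ p : ℝ, ((d : ℝ) + 2) / ((d : ℝ) - 2) ≤ p →
        ∃ C : ℝ, 0 < C ∧ ∀ l : ℝ, 0 < l →
          ∃ u : WeightedModel.Space d → ℝ,
            ContDiff ℝ ∞ u ∧
            (∀ x, 0 < u x) ∧
            WeightedModel.IsRadial g 0 u ∧
            (∀ x, -WeightedModel.weightedLaplacian g f u x = u x ^ p) ∧
            u 0 = l ∧
            (∀ (γ v : ℝ → WeightedModel.Space d) (T : ℝ),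
              WeightedModel.IsGeodesicOn g γ v (Set.Icc 0 T) → γ 0 = 0 → v 0 ≠ 0 →
              StrictAntiOn (fun t => u (γ t)) (Set.Icc 0 T)) ∧
            (∀ x, x ≠ 0 → 0 < WeightedModel.ip g x
              (WeightedModel.grad g f x) (WeightedModel.grad g u x)) ∧
            (∀ x, u x ≤
              (1 / (C * WeightedModel.geodDist g 0 x ^ 2 + l ^ (1 - p))) ^ (1 / (p - 1))) := by
  open WeightedModel in
  have hd' : (3 : ℝ) ≤ d := by exact_mod_cast hd
  have hd0 : (0 : ℝ) < d := by linarith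
  refine ⟨cigarMetric d, potential d, isModelMetric_cigarMetric d, contDiff_potential d,
    isRadial_comp_norm_sq (potentialProfile d), isCompleteMetric_cigarMetric d,
    ricInfty_potential_nonneg hd, fun x _ v hv => ricInfty_potential hd x v hv,
    weightedMeasure_geodBall_le hd, not_laplacianComparison_cigarMetric hd,
    ⟨d, hd0, laplacianComparison_cigarMetric hd⟩, fun p hp => ?_⟩
  have hp1 := (pohozaev_exponent hd' hp).1
  have hp0 : 0 < p - 1 := by linarith
  have hc : 0 < density 0 / (2 * d) := div_pos (density_pos 0) (by linarith)
  -- The rate $(p-1)c$ of the decay estimate with $c=b(0)/(2d)$, independent of $\ell$.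
  refine ⟨(p - 1) * (density 0 / (2 * d)), mul_pos hp0 hc, fun l hl => ?_⟩
  obtain ⟨U, hU, hU0, hpos, hle, hanti, hder⟩ := exists_radial_profile hd hp hl
  have hslope : ∀ s, 0 ≤ s → density 0 / (2 * d) * U s ^ p ≤ slope d (truncPow l p) U s :=
    fun s hs => rpow_le_slope hd (by linarith) hU hpos hle hanti hs
  have hslope_pos : ∀ s, 0 ≤ s → 0 < slope d (truncPow l p) U s := fun s hs =>
    (mul_pos hc (Real.rpow_pos_of_pos (hpos s hs) p)).trans_le (hslope s hs)
  have hstrict : StrictAntiOn U (Set.Ici 0) :=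
    strictAntiOn_of_hasDerivWithinAt_neg (convex_Ici 0) hU.continuousOn
      (fun s _ => (hder s).hasDerivWithinAt)
      fun s hs => neg_lt_zero.2 (hslope_pos s (interior_subset hs))
  refine ⟨fun x => U (‖x‖ ^ 2), contDiff_radial_solution hpos hle hder,
    fun x => hpos _ (sq_nonneg _), isRadial_comp_norm_sq U, fun x => ?_, by simpa using hU0,
    fun γ v T hγ h0 hv => ?_, fun x hx => ?_, fun x => ?_⟩
  · rw [weightedLaplacian_radial_solution hd hpos hle hder, neg_neg]
  · exact hstrict.comp_strictMonoOn (hγ.strictMonoOn_norm_sq h0 hv) fun t _ =>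
      Set.mem_Ici.2 (sq_nonneg _)
  · have hx0 : 0 < ‖x‖ ^ 2 := by positivity
    rw [grad_cigarMetric fun j => pd_potential j x,
      grad_cigarMetric fun j => pd_radial_solution hpos hle hder j x, ip_smul_smul_cigarMetric,
      ← two_mul_slope_eq hpos hle]
    have h1 := hslope_pos _ hx0.le
    exact mul_pos (mul_pos_of_neg_of_neg (potentialSlope_neg hd (one_add_norm_sq_pos x))
      (by linarith)) hx0
  · rw [geodDist_zero_cigarMetric, ← hU0]
    exact le_rpow_of_deriv_le hp1 hpos hder hslope hc (sq_nonneg _)
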